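/- Let $n\ge 0$ and let $\lambda,\mu$ be compositions of $n$ (finite sequences of positive integers with sum $n$). The pair $\frac{\lambda}{\mu}$ is called a meander with $n$ nodes. Its seaweed algebra is the Lie subalgebra of $\mathfrak{gl}_n(\mathbb C)$ consisting of all matrices whose nonzero entries above the diagonal lie in the consecutive diagonal blocks of sizes $\lambda_1,\lambda_2,\dots$ and whose nonzero entries below the diagonal lie in the consecutive diagonal blocks of sizes $\mu_1,\mu_2,\dots$. The index $\mathrm{ind}\bigl(\frac{\lambda}{\mu}\bigr)$ is the index of this Lie algebra, where the index of a finite-dimensional Lie algebra $\mathfrak g$ is $\min_{f\in\mathfrak g^*}\dim\{x\in\mathfrak g: f([x,y])=0\text{ for all }y\in\mathfrak g\}$. For a set $J$ of positive integers let $a^J_{n,k}$ be the number of meanders with $n$ nodes and index $k$ such that all parts of $\lambda$ and $\mu$ lie in $J$, and let $A_J(x,y)=\sum_{n,k\ge0}a^J_{n,k}x^ny^k$ (the empty meander contributes the constant term $1$). A meander with $n\geq 1$ nodes is indecomposable if it is not of the form $\frac{\lambda'|\lambda''}{\mu'|\mu''}$ (concatenation) for meanders $\frac{\lambda'}{\mu'}$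 and $\frac{\lambda''}{\mu''}$ with fewer than $n$ nodes each; let $i_{n,k}$ be the number of indecomposable meanders with $n$ nodes and index $k$ all of whose parts lie in $\{2,3\}$, and put $i_{n,-1}=0$. Theorem. As formal power series, $$A_{\{2,3\}}(x,y)=\frac{1-x-x^3y}{(1-x^2y^2-x^3y^3)(1-x-x^3y)-2x^5y}.$$ Moreover, $i_{n,k}=i_{n-1,k}+i_{n-3,k-1}$ for all $n>6$ and $k\ge0$, and for every integer $c\ge1$, $A_{\{2c,3c\}}(x,y)=A_{\{2,3\}}(x^c,y^c)$. -/

import Mathlib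

section LieIndex

variable {K L : Type*} [Field K] [LieRing L] [LieAlgebra K L]

/-- The stabilizer `L_f = {x | f ⁅x, y⁆ = 0 for all y}` of a linear form `f` under the coadjoint
action. -/
def coadjointStabilizer (f : Module.Dual K L) : Submodule K L where
  carrier := {x | ∀ y : L, f ⁅x, y⁆ = 0}
  add_mem' := by
    intro a b ha hb y
    have h1 : f ⁅a, y⁆ = 0 := ha y
    have h2 : f ⁅b, y⁆ = 0 := hb y
    rw [add_lie, map_add, h1, h2, add_zero]
  zero_mem' := by
    intro y
    simp
  smul_mem' := by
    intro r a ha y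
    have h1 : f ⁅a, y⁆ = 0 := ha y
    rw [smul_lie, map_smul, h1, smul_zero]

variable (K L) in
/-- The index of a (finite-dimensional) Lie algebra: the minimal dimension of the stabilizer of
a linear form. -/
noncomputable def lieIndex : ℕ :=
  ⨅ f : Module.Dual K L, Module.finrank K (coadjointStabilizer f)

end LieIndex

/-- A meander with `n` nodes, recorded by its upper and its lower composition of `n`. -/
@[ext]
structure Meander (n : ℕ) where
  /-- the upper composition -/
  top : Composition n
  /-- the lower composition -/
  bot : Composition n

/-- The block number of a position is a monotone function of the position. -/
theorem Composition.index_le_index {n : ℕ} (c : Composition n) {i j : Fin n} (h : i ≤ j) :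
    c.index i ≤ c.index j := by
  by_contra hlt
  have h1 : ((c.index j).succ : ℕ) ≤ (c.index i : ℕ) := by
    have := not_le.mp hlt
    simpa using this
  have h2 := c.monotone_sizeUpTo h1
  have h3 := c.lt_sizeUpTo_index_succ j
  have h4 := c.sizeUpTo_index_le i
  have h5 : (i : ℕ) ≤ j := h
  omega

/-- If positions `i ≤ k ≤ j` and `i`, `j` lie in the same block, then so does `k`. -/
theorem Composition.index_eq_of_between {n : ℕ} (c : Composition n) {i k j : Fin n}
    (hik : i ≤ k) (hkj : k ≤ j) (h : c.index i = c.index j) :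
    c.index i = c.index k ∧ c.index k = c.index j := by
  have h1 := c.index_le_index hik
  have h2 := c.index_le_index hkj
  exact ⟨le_antisymm h1 (h ▸ h2), le_antisymm h2 (h ▸ h1)⟩

namespace Meander

variable {n : ℕ}

attribute [local instance 100] LieRing.ofAssociativeRing

/-- The positions in which a matrix of the seaweed algebra may have a nonzero entry: above the
diagonal, inside the diagonal blocks given by the upper composition; below the diagonal, inside
the diagonal blocks given by the lower composition; and the diagonal itself. -/
def Allowed (m : Meander n) (i j : Fin n) : Prop :=
  (i < j → m.top.index i = m.top.index j) ∧ (j < i → m.bot.index i = m.bot.index j)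

theorem Allowed.trans {m : Meander n} {i k j : Fin n} (h1 : m.Allowed i k)
    (h2 : m.Allowed k j) : m.Allowed i j := by
  constructor
  · intro hij
    rcases lt_trichotomy i k with hik | hik | hik
    · rcases lt_trichotomy k j with hkj | hkj | hkj
      · exact (h1.1 hik).trans (h2.1 hkj)
      · exact hkj ▸ h1.1 hik
      · exact (m.top.index_eq_of_between hij.le hkj.le (h1.1 hik)).1
    · exact hik ▸ h2.1 (hik ▸ hij)
    · exact (m.top.index_eq_of_between hik.le hij.le (h2.1 (hik.trans hij))).2
  · intro hji
    rcases lt_trichotomy k i with hki | hki | hki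
    · rcases lt_trichotomy j k with hjk | hjk | hjk
      · exact (h1.2 hki).trans (h2.2 hjk)
      · exact hjk ▸ h1.2 hki
      · exact (m.bot.index_eq_of_between hjk.le hji.le (h1.2 hki).symm).2.symm
    · exact hki ▸ h2.2 (hki ▸ hji)
    · exact (m.bot.index_eq_of_between hji.le hki.le (h2.2 (hji.trans hki)).symm).1.symm

theorem mul_supported {m : Meander n} {A B : Matrix (Fin n) (Fin n) ℂ}
    (hA : ∀ i j, A i j ≠ 0 → m.Allowed i j) (hB : ∀ i j, B i j ≠ 0 → m.Allowed i j)
    (i j : Fin n) (h : (A * B) i j ≠ 0) : m.Allowed i j := by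
  rw [Matrix.mul_apply] at h
  obtain ⟨k, -, hk⟩ := Finset.exists_ne_zero_of_sum_ne_zero h
  exact (hA i k (left_ne_zero_of_mul hk)).trans (hB k j (right_ne_zero_of_mul hk))

/-- The seaweed algebra attached to a pair of compositions of `n`, as a Lie subalgebra of the
general linear Lie algebra of complex `n × n` matrices (with the commutator bracket). -/
def seaweed (m : Meander n) : LieSubalgebra ℂ (Matrix (Fin n) (Fin n) ℂ) where
  carrier := {A | ∀ i j, A i j ≠ 0 → m.Allowed i j}
  add_mem' := by
    intro A B hA hB i j h
    by_cases h0 : A i j = 0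
    · refine hB i j fun h1 => h ?_
      rw [Matrix.add_apply, h0, h1, add_zero]
    · exact hA i j h0
  zero_mem' := by
    intro i j h
    exact absurd rfl h
  smul_mem' := by
    intro r A hA i j h
    refine hA i j fun h0 => h ?_
    rw [Matrix.smul_apply, h0, smul_zero]
  lie_mem' := by
    intro A B hA hB i j h
    by_cases h0 : (A * B) i j = 0
    · refine mul_supported hB hA i j fun h1 => h ?_
      rw [Ring.lie_def, Matrix.sub_apply, h0, h1, sub_zero]
    · exact mul_supported hA hB i j h0

/-- The index of a meander: the index of the associated seaweed algebra. -/
noncomputable def ind (m : Meander n) : ℕ :=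
  lieIndex ℂ m.seaweed

/-- All parts of both compositions belong to `J`. -/
def HasPartsIn (J : Set ℕ) (m : Meander n) : Prop :=
  (∀ p ∈ m.top.blocks, p ∈ J) ∧ (∀ p ∈ m.bot.blocks, p ∈ J)

/-- `m` is the direct sum of `m₁` and `m₂`: both its compositions are the concatenations of
those of `m₁` and `m₂`. -/
def IsDirectSum {a b : ℕ} (m : Meander n) (m₁ : Meander a) (m₂ : Meander b) : Prop :=
  m.top.blocks = m₁.top.blocks ++ m₂.top.blocks ∧ m.bot.blocks = m₁.bot.blocks ++ m₂.bot.blocks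

/-- A meander is decomposable if it is the direct sum of strictly smaller meanders. -/
def Decomposable (m : Meander n) : Prop :=
  ∃ (a b : ℕ) (m₁ : Meander a) (m₂ : Meander b), a < n ∧ b < n ∧ m.IsDirectSum m₁ m₂

/-- A (nonempty) meander is indecomposable if it is not decomposable. -/
def Indecomposable (m : Meander n) : Prop :=
  0 < n ∧ ¬ m.Decomposable

end Meander

/-- The number of meanders with `n` nodes, all parts in `J`, and index `k`. -/
noncomputable def meanderCount (J : Set ℕ) (n k : ℕ) : ℕ :=
  Set.ncard {m : Meander n | m.HasPartsIn J ∧ m.ind = k}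

/-- The number of indecomposable meanders with `n` nodes, all parts in `J`, and index `k`. -/
noncomputable def indecMeanderCount (J : Set ℕ) (n k : ℕ) : ℕ :=
  Set.ncard {m : Meander n | m.Indecomposable ∧ m.HasPartsIn J ∧ m.ind = k}

/-- The generating function `∑ a_{n,k} x ^ n y ^ k` of `meanderCount J`, a formal power series in
the variables `x = X 0` and `y = X 1`. -/
noncomputable def meanderGenFun (J : Set ℕ) : MvPowerSeries (Fin 2) ℚ :=
  fun d => (meanderCount J (d 0) (d 1) : ℚ)

/-- The set of meanders with `n` nodes is finite, so that the counts above are genuine. -/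
instance Meander.instFinite (n : ℕ) : Finite (Meander n) :=
  Finite.of_injective (fun m : Meander n => (m.top, m.bot)) (by
    intro a b h
    exact Meander.ext (congrArg Prod.fst h) (congrArg Prod.snd h))

/-! The seaweed algebra consists of the matrices supported on a reflexive transitive relation on the
nodes. By the trace pairing, its index is the minimal dimension, over forms `F`, of the space of
supported `s` for which `F * s - s * F` vanishes in the positions dual to the relation. If all
blocks are multiples of `c`, the same algebra is an incidence algebra on a node set `c` times
smaller, with coefficients in `Matrix (Fin c) (Fin c) ℂ` (`incIndex_comp`,
`Meander.ind_eq_listIndex`); the reductions are therefore carried out over matrix coefficients.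

The index is computed by removing the first node. Semicontinuity of kernel dimensions lets one
chosen entry of an optimal form be invertible, conjugation by units of the algebra brings its row
and column to normal form, and the stabilizer equations at the removed node can then be solved
(`finrank_incStab_removeLeaf`, `finrank_incStab_removeTwin`). On leading blocks this gives cases of
Panyushev's reduction: `(1|l)/(2|m)` becomes `l/(1|m)`, `(1|l)/(3|m)` becomes `l/(1|1|m)`, and
`(2|l)/(3|m)` becomes `(1|l)/(2|m)`. Equal leading blocks `k` split off and contribute `k * c`
(`listIndex_cons_cons`).

For parts 2 and 3 only three states occur: equal remaining sums, excess 1 with one pending block 1,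
and excess 2 with two pending blocks 1. Reading the next part is a transition of this automaton, and
each transition raises the index by a multiple of `c` that depends on `c` only through this factor;
hence the inflation formula (`pairIndex_eq_mul`).

Let `B` be the series of a set of balanced endpoints, and `P`, `Q` the series of walks that start
with excess 1, 2 and end there. Then `P = x P + x Q` and `Q = x²y (B + P)`, and the walks that leave
equal sums and first return in `B` have the series `(x²y² + x³y³) B + 2 x² P`. Eliminating `P` and
`Q` gives `pairGenFun_firstReturnSet_mul`. With all balanced pairs as endpoints, `A = 1 + first
returns` yields the closed form. With only the empty pair, the walks are the indecomposable
meanders, because a decomposition is an earlier return to equal sums; their series times `1 - x -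
x³y` is a polynomial of degree 6 in `x`, whence the recurrence beyond 6. -/

section SeaweedIndex

open Module Filter

/-! ### Semicontinuity of kernels along lines of linear maps -/

section Pencil

/-- A determinant that is nonzero at one point of a line is nonzero at almost every point. -/
theorem Matrix.eventually_det_add_smul_ne_zero {n : Type*} [Fintype n] [DecidableEq n]
    (A B : Matrix n n ℂ) (t₀ : ℂ) (h : (A + t₀ • B).det ≠ 0) :
    ∀ᶠ t : ℂ in cofinite, (A + t • B).det ≠ 0 := by
  set p : Polynomial ℂ := (A.map Polynomial.C + (Polynomial.X : Polynomial ℂ) • B.map Polynomial.C).det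
    with hp
  have heval : ∀ t : ℂ, p.eval t = (A + t • B).det := by
    intro t
    rw [hp, ← Polynomial.coe_evalRingHom, RingHom.map_det]
    congr 1
    ext i j
    simp
    exact mul_comm _ _
  have hp0 : p ≠ 0 := by
    intro h0
    apply h
    rw [← heval, h0, Polynomial.eval_zero]
  refine (p.roots.toFinset.finite_toSet).subset ?_
  intro t ht
  have : (A + t • B).det = 0 := by simpa using ht
  simp only [Finset.mem_coe, Multiset.mem_toFinset, Polynomial.mem_roots hp0, Polynomial.IsRoot.def]
  rw [heval, this]

theorem LinearMap.eventually_det_id_add_smul_ne_zero {V : Type*} [AddCommGroup V] [Module ℂ V]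
    [FiniteDimensional ℂ V] (B : V →ₗ[ℂ] V) :
    ∀ᶠ t : ℂ in cofinite, LinearMap.det (LinearMap.id + t • B) ≠ 0 := by
  have h := Matrix.eventually_det_add_smul_ne_zero
    (LinearMap.toMatrix (finBasis ℂ V) (finBasis ℂ V) LinearMap.id)
    (LinearMap.toMatrix (finBasis ℂ V) (finBasis ℂ V) B) 0 (by simp)
  filter_upwards [h] with t ht
  rwa [← LinearMap.det_toMatrix (finBasis ℂ V), map_add, map_smul]

/-- The dimension of the kernel is upper semicontinuous along lines of linear maps. -/
theorem LinearMap.eventually_finrank_ker_add_smul_le {V W : Type*} [AddCommGroup V] [Module ℂ V]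
    [FiniteDimensional ℂ V] [AddCommGroup W] [Module ℂ W] (A B : V →ₗ[ℂ] W) :
    ∀ᶠ t : ℂ in cofinite, finrank ℂ (A + t • B).ker ≤ finrank ℂ A.ker := by
  -- On a complement `U` of the kernel, `A` has a left inverse `P`, and `P ∘ (A + t B)` on `U` is `1
  -- + t P B`. Where this is invertible, the kernel of `A + t B` meets `U` trivially, so it is no
  -- larger than the kernel of `A`.
  obtain ⟨U, hU⟩ := A.ker.exists_isCompl
  have hinj : (A.domRestrict U).ker = ⊥ := by
    rw [LinearMap.ker_eq_bot']
    rintro ⟨u, hu⟩ h0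
    have : u ∈ A.ker ⊓ U := ⟨h0, hu⟩
    rw [hU.inf_eq_bot] at this
    ext
    simpa using this
  obtain ⟨P, hP⟩ := (A.domRestrict U).exists_leftInverse_of_injective hinj
  filter_upwards [LinearMap.eventually_det_id_add_smul_ne_zero (P ∘ₗ B.domRestrict U)] with t ht
  have hcomp : LinearMap.id + t • (P ∘ₗ B.domRestrict U) = P ∘ₗ (A + t • B).domRestrict U := by
    rw [← hP]
    ext u
    simp
  rw [hcomp] at ht
  have hdisj : (A + t • B).ker ⊓ U = ⊥ := by
    rw [eq_bot_iff]
    rintro u ⟨hu, hu'⟩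
    have h0 : (P ∘ₗ (A + t • B).domRestrict U) ⟨u, hu'⟩ = 0 := by
      have h1 : (A + t • B) u = 0 := hu
      change P ((A + t • B) u) = 0
      rw [h1, map_zero]
    have hk := LinearEquiv.injective (LinearEquiv.ofIsUnitDet (v := finBasis ℂ U) (v' := finBasis ℂ U)
      (f := P ∘ₗ (A + t • B).domRestrict U) (by
        rw [LinearMap.det_toMatrix]; exact isUnit_iff_ne_zero.mpr ht))
    have h2 := hk (a₁ := ⟨u, hu'⟩) (a₂ := 0) (by rw [map_zero]; exact h0)
    exact congrArg Subtype.val h2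
  have h1 := Submodule.finrank_add_finrank_le_of_disjoint (disjoint_iff.mpr hdisj)
  have h2 := Submodule.finrank_add_eq_of_isCompl hU
  omega

end Pencil

/-! ### Incidence algebras with coefficients and their index -/

section Incidence

variable {ι D : Type} [Fintype ι] [Ring D] [Algebra ℂ D]

/-- The stabilizer, inside the incidence algebra of the relation `R` with coefficients in `D`, of
the linear form attached to the matrix `F` by the trace pairing. -/
def incStab (R : ι → ι → Prop) (F : Matrix ι ι D) : Submodule ℂ (Matrix ι ι D) where
  carrier := {s | (∀ i j, ¬ R i j → s i j = 0) ∧ ∀ i j, R i j → (F * s) j i = (s * F) j i}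
  add_mem' := by
    rintro a b ⟨ha, ha'⟩ ⟨hb, hb'⟩
    refine ⟨fun i j h => ?_, fun i j h => ?_⟩
    · rw [Matrix.add_apply, ha i j h, hb i j h, add_zero]
    · rw [mul_add, add_mul, Matrix.add_apply, Matrix.add_apply, ha' i j h, hb' i j h]
  zero_mem' := by simp
  smul_mem' := by
    rintro r a ⟨ha, ha'⟩
    refine ⟨fun i j h => ?_, fun i j h => ?_⟩
    · rw [Matrix.smul_apply, ha i j h, smul_zero]
    · rw [Matrix.mul_smul, Matrix.smul_mul, Matrix.smul_apply, Matrix.smul_apply, ha' i j h]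

theorem mem_incStab {R : ι → ι → Prop} {F s : Matrix ι ι D} :
    s ∈ incStab R F ↔
      (∀ i j, ¬ R i j → s i j = 0) ∧ ∀ i j, R i j → (F * s) j i = (s * F) j i :=
  Iff.rfl

variable (D) in
/-- The index of the incidence algebra of the relation `R` with coefficients in `D`. -/
noncomputable def incIndex (R : ι → ι → Prop) : ℕ :=
  ⨅ F : Matrix ι ι D, finrank ℂ (incStab R F)

theorem incIndex_le (R : ι → ι → Prop) (F : Matrix ι ι D) :
    incIndex D R ≤ finrank ℂ (incStab R F) :=
  ciInf_le (OrderBot.bddBelow _) F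

variable (D) in
theorem exists_finrank_incStab_eq (R : ι → ι → Prop) :
    ∃ F : Matrix ι ι D, finrank ℂ (incStab R F) = incIndex D R :=
  Nat.sInf_mem (Set.range_nonempty _)

/-- Only the entries of `F` that pair with the incidence algebra matter. -/
theorem incStab_congr {R : ι → ι → Prop} (hR : ∀ i j k, R i j → R j k → R i k)
    {F G : Matrix ι ι D} (h : ∀ i j, R i j → F j i = G j i) : incStab R F = incStab R G := by
  have key : ∀ F G : Matrix ι ι D, (∀ i j, R i j → F j i = G j i) →
      incStab R F ≤ incStab R G := by
    rintro F G h s ⟨hs, hs'⟩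
    refine ⟨hs, fun i j hij => ?_⟩
    have h1 : (F * s) j i = (G * s) j i := by
      simp only [Matrix.mul_apply]
      refine Finset.sum_congr rfl fun k _ => ?_
      by_cases hk : R k i
      · rw [h k j (hR _ _ _ hk hij)]
      · rw [hs k i hk, mul_zero, mul_zero]
    have h2 : (s * F) j i = (s * G) j i := by
      simp only [Matrix.mul_apply]
      refine Finset.sum_congr rfl fun k _ => ?_
      by_cases hk : R j k
      · rw [h i k (hR _ _ _ hij hk)]
      · rw [hs j k hk, zero_mul, zero_mul]
    rw [← h1, ← h2, hs' i j hij]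
  exact le_antisymm (key F G h) (key G F fun i j hij => (h i j hij).symm)

omit [Algebra ℂ D] in
theorem mul_apply_eq_zero_of_not_rel {R : ι → ι → Prop} (hR : ∀ i j k, R i j → R j k → R i k)
    {a b : Matrix ι ι D} (ha : ∀ i j, ¬ R i j → a i j = 0) (hb : ∀ i j, ¬ R i j → b i j = 0)
    (i j : ι) (h : ¬ R i j) : (a * b) i j = 0 := by
  rw [Matrix.mul_apply]
  refine Finset.sum_eq_zero fun k _ => ?_
  by_cases hk : R i k
  · rw [hb k j fun h' => h (hR _ _ _ hk h'), mul_zero]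
  · rw [ha i k hk, zero_mul]

omit [Algebra ℂ D] in
/-- Matrices orthogonal to the incidence algebra form a bimodule over it. -/
theorem mul_mul_apply_eq_zero_of_rel {R : ι → ι → Prop} (hR : ∀ i j k, R i j → R j k → R i k)
    {u v M : Matrix ι ι D} (hu : ∀ i j, ¬ R i j → u i j = 0) (hv : ∀ i j, ¬ R i j → v i j = 0)
    (hM : ∀ i j, R i j → M j i = 0) (i j : ι) (h : R i j) : (u * M * v) j i = 0 := by
  simp only [Matrix.mul_apply]
  refine Finset.sum_eq_zero fun l _ => ?_
  by_cases hl : R l i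
  · rw [Finset.sum_eq_zero, zero_mul]
    intro k _
    by_cases hk : R j k
    · rw [hM l k (hR _ _ _ hl (hR _ _ _ h hk)), mul_zero]
    · rw [hu j k hk, zero_mul]
  · rw [hv l i hl, mul_zero]

theorem finrank_le_of_injOn {V W : Type*} [AddCommGroup V] [Module ℂ V] [AddCommGroup W]
    [Module ℂ W] [FiniteDimensional ℂ W] {S : Submodule ℂ V} {T : Submodule ℂ W} (f : V →ₗ[ℂ] W)
    (hf : ∀ x ∈ S, f x ∈ T) (hinj : ∀ x ∈ S, f x = 0 → x = 0) : finrank ℂ S ≤ finrank ℂ T := by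
  refine LinearMap.finrank_le_finrank_of_injective (f := f.restrict hf) ?_
  rw [← LinearMap.ker_eq_bot, LinearMap.ker_eq_bot']
  rintro ⟨x, hx⟩ h
  ext
  exact hinj x hx (congrArg Subtype.val h)

theorem finrank_eq_of_map {V W : Type*} [AddCommGroup V] [Module ℂ V] [AddCommGroup W]
    [Module ℂ W] {S : Submodule ℂ V} {T : Submodule ℂ W} (f : V →ₗ[ℂ] W)
    (hf : ∀ x ∈ S, f x ∈ T) (hinj : ∀ x ∈ S, f x = 0 → x = 0)
    (hsurj : ∀ y ∈ T, ∃ x ∈ S, f x = y) : finrank ℂ S = finrank ℂ T := by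
  refine LinearEquiv.finrank_eq (LinearEquiv.ofBijective (f.restrict hf) ⟨?_, ?_⟩)
  · rw [← LinearMap.ker_eq_bot, LinearMap.ker_eq_bot']
    rintro ⟨x, hx⟩ h
    ext
    exact hinj x hx (congrArg Subtype.val h)
  · rintro ⟨y, hy⟩
    obtain ⟨x, hx, rfl⟩ := hsurj y hy
    exact ⟨⟨x, hx⟩, rfl⟩

/-- Conjugating the form by a unit of the incidence algebra conjugates the stabilizer. -/
theorem finrank_incStab_conj [DecidableEq ι] {R : ι → ι → Prop}
    (hR : ∀ i j k, R i j → R j k → R i k) {u v : Matrix ι ι D} (hu : ∀ i j, ¬ R i j → u i j = 0)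
    (hv : ∀ i j, ¬ R i j → v i j = 0) (huv : u * v = 1) (hvu : v * u = 1) (F : Matrix ι ι D) :
    finrank ℂ (incStab R (u * F * v)) = finrank ℂ (incStab R F) := by
  have key : ∀ u v F : Matrix ι ι D, (∀ i j, ¬ R i j → u i j = 0) →
      (∀ i j, ¬ R i j → v i j = 0) → v * u = 1 → ∀ s ∈ incStab R F,
      u * s * v ∈ incStab R (u * F * v) := by
    rintro u v F hu hv hvu s ⟨hs, hs'⟩
    refine ⟨mul_apply_eq_zero_of_not_rel hR (mul_apply_eq_zero_of_not_rel hR hu hs) hv, ?_⟩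
    intro i j hij
    -- The commutator with the conjugated form is the conjugate of the commutator. Being orthogonal
    -- to the incidence algebra survives multiplication by `u` and `v` on either side.
    rw [← sub_eq_zero, ← Matrix.sub_apply]
    have : u * F * v * (u * s * v) - u * s * v * (u * F * v) = u * (F * s - s * F) * v := by
      have h1 : u * F * v * (u * s * v) = u * F * (v * u) * (s * v) := by noncomm_ring
      have h2 : u * s * v * (u * F * v) = u * s * (v * u) * (F * v) := by noncomm_ring
      rw [h1, h2, hvu]
      noncomm_ring
    rw [this]
    refine mul_mul_apply_eq_zero_of_rel hR hu hv (fun a b hab => ?_) i j hij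
    rw [Matrix.sub_apply, hs' a b hab, sub_self]
  symm
  refine finrank_eq_of_map (LinearMap.mulLeft ℂ u ∘ₗ LinearMap.mulRight ℂ v) ?_ ?_ ?_
  · intro s hs
    simpa [mul_assoc] using key u v F hu hv hvu s hs
  · intro s hs h
    have h' : u * (s * v) = 0 := h
    have : s = v * (u * (s * v)) * u := by
      rw [← mul_assoc v u, hvu, one_mul, mul_assoc, hvu, mul_one]
    rw [this, h', mul_zero, zero_mul]
  · intro s hs
    refine ⟨v * s * u, ?_, ?_⟩
    · have := key v u _ hv hu huv s hs
      have h2 : v * (u * F * v) * u = (v * u) * F * (v * u) := by noncomm_ring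
      rwa [h2, hvu, one_mul, mul_one] at this
    · change u * ((v * s * u) * v) = s
      have : u * ((v * s * u) * v) = (u * v) * s * (u * v) := by noncomm_ring
      rw [this, huv, one_mul, mul_one]

/-- The linear map whose kernel is the stabilizer. -/
noncomputable def incStabMap (R : ι → ι → Prop) (F : Matrix ι ι D) :
    Matrix ι ι D →ₗ[ℂ] (ι → ι → D) where
  toFun s := fun i j => open Classical in if R i j then (F * s - s * F) j i else s i j
  map_add' := by
    intro a b
    ext i j
    by_cases h : R i j
    · simp [h, mul_add, add_mul]; abel
    · simp [h]
  map_smul' := by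
    intro r a
    ext i j
    by_cases h : R i j
    · simp [h, smul_sub]
    · simp [h]

theorem ker_incStabMap (R : ι → ι → Prop) (F : Matrix ι ι D) :
    (incStabMap R F).ker = incStab R F := by
  ext s
  rw [LinearMap.mem_ker, mem_incStab]
  constructor
  · intro h
    refine ⟨fun i j hij => ?_, fun i j hij => ?_⟩
    · simpa [incStabMap, hij] using congrFun (congrFun h i) j
    · simpa [incStabMap, hij, sub_eq_zero] using congrFun (congrFun h i) j
  · rintro ⟨h1, h2⟩
    ext i j
    by_cases h : R i j
    · simp [incStabMap, h, h2]
    · simp [incStabMap, h, h1]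

/-- The stabilizer is a kernel, so semicontinuity along lines applies. `incStabMap R F` is only
affine in `F`, since its components off the relation do not involve `F`; the direction of the pencil
is thus a difference of two of its values. -/
theorem eventually_finrank_incStab_add_smul_le [FiniteDimensional ℂ D] (R : ι → ι → Prop)
    (F G : Matrix ι ι D) :
    ∀ᶠ t : ℂ in cofinite, finrank ℂ (incStab R (F + t • G)) ≤ finrank ℂ (incStab R F) := by
  have h := LinearMap.eventually_finrank_ker_add_smul_le (incStabMap R F)
    (incStabMap R (F + G) - incStabMap R F)
  filter_upwards [h] with t ht
  rw [ker_incStabMap] at ht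
  have hmap : incStabMap R (F + t • G) =
      incStabMap R F + t • (incStabMap R (F + G) - incStabMap R F) := by
    refine LinearMap.ext fun s => funext fun i => funext fun j => ?_
    by_cases h : R i j
    · simp only [incStabMap, add_mul, mul_add, smul_sub, LinearMap.coe_mk, AddHom.coe_mk, h,
        LinearMap.add_apply, LinearMap.smul_apply, LinearMap.sub_apply, Pi.add_apply,
        Pi.smul_apply, Pi.sub_apply, if_true, Matrix.add_apply, Matrix.sub_apply,
        Matrix.smul_mul, Matrix.mul_smul, Matrix.smul_apply, smul_add]
      abel
    · simp [incStabMap, h]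
  rwa [← ker_incStabMap, hmap]

end Incidence

/-! ### Stabilizer equations at a node that reaches no other node -/

section Removal

variable {D : Type} [Ring D] [Algebra ℂ D] {N : ℕ}

/-- Restriction of a matrix to the nodes different from `0`, as a linear map. -/
def succSubmatrix (D : Type) [Ring D] [Algebra ℂ D] (N : ℕ) :
    Matrix (Fin (N + 1)) (Fin (N + 1)) D →ₗ[ℂ] Matrix (Fin N) (Fin N) D where
  toFun s := s.submatrix Fin.succ Fin.succ
  map_add' _ _ := rfl
  map_smul' _ _ := rfl

theorem succSubmatrix_apply (s : Matrix (Fin (N + 1)) (Fin (N + 1)) D) (i j : Fin N) :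
    succSubmatrix D N s i j = s i.succ j.succ := rfl

/-- The relation left after the removal of a node `0` that is only reached from nodes below `q`. -/
def removeLeaf (R : Fin (N + 1) → Fin (N + 1) → Prop) (q : Fin N) (i j : Fin N) : Prop :=
  R i.succ j.succ ∧ ¬ (i = q ∧ j ≠ q ∧ R j.succ 0)

/-- With row `0` of the form equal to the unit vector at `q`, the equations of the arrows into `0`
kill the entries `s q i` for the other predecessors `i` of `0`, which explains the arrows dropped by
`removeLeaf`. They also force `s 0 0 = s q q`. The equations of the arrows from `q` to predecessors
of `0` express column `0` of `s` through the rest. The corner `F 0 0` survives as a correction at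
`(q, q)`. -/
theorem finrank_incStab_removeLeaf {R : Fin (N + 1) → Fin (N + 1) → Prop} (hrefl : ∀ i, R i i)
    (htrans : ∀ i j k, R i j → R j k → R i k) {q : Fin N} (h0 : ∀ j : Fin N, ¬ R 0 j.succ)
    (hq : R q.succ 0) (hq' : ∀ i : Fin N, R i.succ 0 → R q.succ i.succ)
    (F : Matrix (Fin (N + 1)) (Fin (N + 1)) D)
    (hF : ∀ j : Fin N, F 0 j.succ = if j = q then 1 else 0) (hF' : ∀ j : Fin N, F j.succ 0 = 0) :
    finrank ℂ (incStab R F) = finrank ℂ (incStab (removeLeaf R q)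
      (succSubmatrix D N F + Matrix.single q q (F 0 0))) := by
  have hrow : ∀ s ∈ incStab R F, ∀ j : Fin N, s 0 j.succ = 0 := fun s hs j => hs.1 _ _ (h0 j)
  -- `e1`, `e2`, `e3` are the equations of the arrows into `0` from other predecessors, from `q` and
  -- from `0` itself; `e4` is that of the arrow from `q` to `i`.
  have e1 : ∀ s ∈ incStab R F, ∀ i : Fin N, R i.succ 0 → i ≠ q → s q.succ i.succ = 0 := by
    intro s hs i hi hiq
    have := hs.2 _ _ hi
    simpa [Matrix.mul_apply, Fin.sum_univ_succ, hF, hF', hrow s hs, hiq] using this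
  have e2 : ∀ s ∈ incStab R F, s 0 0 = s q.succ q.succ := by
    intro s hs
    have := hs.2 _ _ hq
    simpa [Matrix.mul_apply, Fin.sum_univ_succ, hF, hF', hrow s hs, eq_comm] using this
  have e3 : ∀ s ∈ incStab R F, F 0 0 * s 0 0 + s q.succ 0 = s 0 0 * F 0 0 := by
    intro s hs
    have := hs.2 _ _ (hrefl 0)
    simpa [Matrix.mul_apply, Fin.sum_univ_succ, hF, hF', hrow s hs] using this
  have e4 : ∀ s ∈ incStab R F, ∀ i : Fin N, R i.succ 0 → s i.succ 0 =
      (succSubmatrix D N F * succSubmatrix D N s) i q -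
        (succSubmatrix D N s * succSubmatrix D N F) i q := by
    intro s hs i hi
    have := hs.2 _ _ (hq' i hi)
    rw [Matrix.mul_apply, Matrix.mul_apply, Fin.sum_univ_succ, Fin.sum_univ_succ, hF', hF] at this
    simp only [zero_mul, zero_add, if_true, mul_one] at this
    rw [Matrix.mul_apply, Matrix.mul_apply]
    simp only [succSubmatrix_apply]
    rw [this]
    abel
  refine finrank_eq_of_map (succSubmatrix D N) ?_ ?_ ?_
  · intro s hs
    refine ⟨fun i j hij => ?_, fun i j hij => ?_⟩
    · rw [succSubmatrix_apply]
      by_cases h : R i.succ j.succ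
      · have : i = q ∧ j ≠ q ∧ R j.succ 0 := by
          by_contra h'
          exact hij ⟨h, h'⟩
        rw [this.1]
        exact e1 s hs j this.2.2 this.2.1
      · exact hs.1 _ _ h
    · obtain ⟨hij, hne⟩ := hij
      have key := hs.2 _ _ hij
      rw [Matrix.mul_apply, Matrix.mul_apply, Fin.sum_univ_succ, Fin.sum_univ_succ, hF', hF] at key
      simp only [zero_mul, zero_add] at key
      rw [add_mul, mul_add, Matrix.add_apply, Matrix.add_apply,
        Matrix.mul_apply (M := succSubmatrix D N F), Matrix.mul_apply (N := succSubmatrix D N F)]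
      simp only [succSubmatrix_apply]
      rw [key]
      by_cases hi : i = q
      · subst hi
        by_cases hj : j = i
        · subst hj
          have h3 := e3 s hs
          rw [e2 s hs] at h3
          simp only [if_true, mul_one, Matrix.single_mul_apply_same, Matrix.mul_single_apply_same,
            succSubmatrix_apply]
          rw [← h3]
          abel
        · have : ¬ R j.succ 0 := fun h => hne ⟨rfl, hj, h⟩
          rw [hs.1 _ _ this, Matrix.single_mul_apply_of_ne _ _ _ _ _ hj,
            Matrix.mul_single_apply_same, succSubmatrix_apply,
            hs.1 j.succ i.succ fun h => this (htrans _ _ _ h hq)]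
          simp
      · rw [Matrix.mul_single_apply_of_ne _ _ _ _ _ hi]
        by_cases hj : j = q
        · subst hj
          rw [Matrix.single_mul_apply_same, succSubmatrix_apply,
            e1 s hs i (htrans _ _ _ hij hq) hi]
          simp [hi]
        · rw [Matrix.single_mul_apply_of_ne _ _ _ _ _ hj]
          simp [hi]
  · intro s hs h
    have hss : ∀ i j : Fin N, s i.succ j.succ = 0 := fun i j => congrFun (congrFun h i) j
    ext i j
    refine Fin.cases ?_ (fun i => ?_) i
    · refine Fin.cases ?_ (fun j => hrow s hs j) j
      rw [e2 s hs, hss, Matrix.zero_apply]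
    · refine Fin.cases ?_ (fun j => hss i j) j
      by_cases hi : R i.succ 0
      · rw [e4 s hs i hi, h]
        simp
      · exact hs.1 _ _ hi
  · intro s hs
    classical
    have hsR : ∀ i j : Fin N, ¬ R i.succ j.succ → s i j = 0 := fun i j h => hs.1 i j fun h' => h h'.1
    have hsq : ∀ i : Fin N, R i.succ 0 → i ≠ q → s q i = 0 :=
      fun i hi hiq => hs.1 _ _ fun h => h.2 ⟨rfl, hiq, hi⟩
    -- The preimage is forced: its corner is given by `e2` and its column `0` by `e4`.
    set t : Matrix (Fin (N + 1)) (Fin (N + 1)) D := Matrix.of fun i j =>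
      Fin.cases (Fin.cases (s q q) (fun _ => 0) j) (fun i => Fin.cases
        (if R i.succ 0 then (succSubmatrix D N F * s) i q - (s * succSubmatrix D N F) i q else 0)
        (fun j => s i j) j) i with ht
    have t00 : t 0 0 = s q q := rfl
    have t0 : ∀ j : Fin N, t 0 j.succ = 0 := fun _ => rfl
    have t1 : ∀ i : Fin N, t i.succ 0 = if R i.succ 0 then
      (succSubmatrix D N F * s) i q - (s * succSubmatrix D N F) i q else 0 := fun _ => rfl
    have t2 : ∀ i j : Fin N, t i.succ j.succ = s i j := fun _ _ => rfl
    have hR' : removeLeaf R q q q := ⟨hrefl _, fun h => h.2.1 rfl⟩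
    have tq : t q.succ 0 = s q q * F 0 0 - F 0 0 * s q q := by
      rw [t1, if_pos hq]
      have := hs.2 q q hR'
      rw [add_mul, mul_add, Matrix.add_apply, Matrix.add_apply, Matrix.single_mul_apply_same,
        Matrix.mul_single_apply_same] at this
      rw [sub_eq_sub_iff_add_eq_add, this, add_comm]
    refine ⟨t, ⟨?_, ?_⟩, rfl⟩
    · intro i j
      refine Fin.cases ?_ (fun i => ?_) i
      · refine Fin.cases ?_ (fun j => ?_) j
        · exact fun h => absurd (hrefl 0) h
        · exact fun _ => rfl
      · refine Fin.cases ?_ (fun j => ?_) j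
        · intro h
          rw [t1, if_neg h]
        · exact hsR i j
    · intro i j
      rw [Matrix.mul_apply, Matrix.mul_apply, Fin.sum_univ_succ, Fin.sum_univ_succ]
      refine Fin.cases ?_ (fun i => ?_) i
      · refine Fin.cases ?_ (fun j => ?_) j
        · intro _
          simp [hF, t0, t00, tq]
        · exact fun h => absurd h (h0 j)
      · refine Fin.cases ?_ (fun j => ?_) j
        · intro hi
          by_cases hiq : i = q
          · simp [hF, t0, t2, t00, hiq]
          · simp [hF, t0, t2, hiq, hsq i hi hiq]
        · intro hij
          rw [t0, hF', hF, mul_zero, zero_add, t1]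
          simp only [t2]
          by_cases hiq : i = q
          · subst hiq
            by_cases hj : R j.succ 0
            · rw [if_pos hj, if_pos rfl, mul_one, Matrix.mul_apply, Matrix.mul_apply]
              simp [succSubmatrix_apply]
            · have hjq : j ≠ i := fun h => hj (h ▸ hq)
              have := hs.2 i j ⟨hij, fun h => hj h.2.2⟩
              rw [add_mul, mul_add, Matrix.add_apply, Matrix.add_apply,
                Matrix.single_mul_apply_of_ne _ _ _ _ _ hjq, Matrix.mul_single_apply_same,
                hsR j i fun h => hj (htrans _ _ _ h hq)] at this
              simpa [hj, Matrix.mul_apply, succSubmatrix_apply] using this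
          · have := hs.2 i j ⟨hij, fun h => hiq h.1⟩
            rw [add_mul, mul_add, Matrix.add_apply, Matrix.add_apply,
              Matrix.mul_single_apply_of_ne _ _ _ _ _ hiq] at this
            have hz : (Matrix.single q q (F 0 0) * s) j i = 0 := by
              by_cases hjq : j = q
              · subst hjq
                rw [Matrix.single_mul_apply_same, hsq i (htrans _ _ _ hij hq) hiq, mul_zero]
              · rw [Matrix.single_mul_apply_of_ne _ _ _ _ _ hjq]
            rw [hz] at this
            simpa [hiq, Matrix.mul_apply, succSubmatrix_apply] using this

end Removal

/-! ### Stabilizer equations at a node equivalent to all nodes it reaches -/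

section RemovalTwin

variable {D : Type} [Ring D] [Algebra ℂ D] {N : ℕ}

open Classical in
/-- Restriction of a matrix to the nodes different from `0`, where the entries of the row `q` in
the columns equivalent to `0` are replaced by those of the row `0`. -/
noncomputable def twinSubmatrix (D : Type) [Ring D] [Algebra ℂ D] {N : ℕ}
    (R : Fin (N + 1) → Fin (N + 1) → Prop) (q : Fin N) :
    Matrix (Fin (N + 1)) (Fin (N + 1)) D →ₗ[ℂ] Matrix (Fin N) (Fin N) D where
  toFun s := Matrix.of fun i j => if i = q ∧ R 0 j.succ then s 0 j.succ else s i.succ j.succ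
  map_add' a b := by
    ext i j
    by_cases h : i = q ∧ R 0 j.succ
    · simp only [Matrix.of_apply, Matrix.add_apply, if_pos h]
    · simp only [Matrix.of_apply, Matrix.add_apply, if_neg h]
  map_smul' r a := by
    ext i j
    by_cases h : i = q ∧ R 0 j.succ
    · simp only [Matrix.of_apply, Matrix.smul_apply, if_pos h, RingHom.id_apply]
    · simp only [Matrix.of_apply, Matrix.smul_apply, if_neg h, RingHom.id_apply]

open Classical in
/-- The form on the smaller incidence algebra that corresponds to `twinSubmatrix`. -/
noncomputable def twinForm (R : Fin (N + 1) → Fin (N + 1) → Prop) (q : Fin N)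
    (F : Matrix (Fin (N + 1)) (Fin (N + 1)) D) : Matrix (Fin N) (Fin N) D :=
  Matrix.of fun i j => if j = q ∧ R 0 i.succ then F i.succ 0 else F i.succ j.succ

/-- Let `X` be the set of other nodes equivalent to `0`. In normal form the equations give `s 0 0 =
s q q`, make `s` vanish from `X` to `0`, and express `s q 0` and the entries from `q` to `X` through
row `0`. So row `0` over `X` is free while row `q` over `X` is determined; in the smaller algebra
the former takes the place of the latter, and in the form the column `0` over `X` takes the place of
column `q`. -/
theorem finrank_incStab_removeTwin {R : Fin (N + 1) → Fin (N + 1) → Prop} (hrefl : ∀ i, R i i)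
    (htrans : ∀ i j k, R i j → R j k → R i k) {q : Fin N}
    (h1 : ∀ w : Fin N, R 0 w.succ → R w.succ 0) (hq : R q.succ 0) (hq' : ¬ R 0 q.succ)
    (h3 : ∀ i : Fin N, R i.succ 0 → i = q ∨ R 0 i.succ)
    (h4 : ∀ i : Fin N, R i.succ q.succ → i = q)
    (F : Matrix (Fin (N + 1)) (Fin (N + 1)) D) (hF0 : F 0 0 = 0)
    (hF : ∀ j : Fin N, F 0 j.succ = if j = q then 1 else 0)
    (hF' : ∀ j : Fin N, R 0 j.succ → F j.succ q.succ = 0) :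
    finrank ℂ (incStab R F) =
      finrank ℂ (incStab (fun i j : Fin N => R i.succ j.succ) (twinForm R q F)) := by
  classical
  have hXY : ∀ i j : Fin N, R i.succ j.succ → R 0 i.succ → R 0 j.succ :=
    fun i j h h' => htrans _ _ _ h' h
  have hYX : ∀ i j : Fin N, i ≠ q → R i.succ j.succ → R 0 j.succ → R 0 i.succ :=
    fun i j hi h h' => (h3 i (htrans _ _ _ h (h1 j h'))).resolve_left hi
  have hneq : ∀ i : Fin N, R 0 i.succ → i ≠ q := fun i h h' => hq' (h' ▸ h)
  -- No other remaining node reaches `q`, so column `q` of a supported matrix has at most its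
  -- diagonal entry.
  have col : ∀ s : Matrix (Fin N) (Fin N) D, (∀ i j : Fin N, ¬ R i.succ j.succ → s i j = 0) →
      ∀ G : Fin N → D, ∑ k, G k * s k q = G q * s q q := by
    intro s hs G
    refine Finset.sum_eq_single q (fun k _ hk => ?_) (fun h => absurd (Finset.mem_univ _) h)
    rw [hs k q fun h => hk (h4 k h), mul_zero]
  have col' : ∀ s : Matrix (Fin (N + 1)) (Fin (N + 1)) D, (∀ i j, ¬ R i j → s i j = 0) →
      ∀ G : Fin N → D, ∑ k : Fin N, G k * s k.succ q.succ = G q * s q.succ q.succ :=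
    fun s hs G => col (succSubmatrix D N s) (fun i j h => hs _ _ h) G
  have c1 : ∀ s ∈ incStab R F, s 0 0 = s q.succ q.succ := by
    intro s hs
    have := hs.2 _ _ hq
    rw [Matrix.mul_apply, Matrix.mul_apply, Fin.sum_univ_succ, Fin.sum_univ_succ, hF0, zero_mul,
      zero_add, hF, if_pos rfl, mul_one, Finset.sum_eq_zero (f := fun k : Fin N => s 0 k.succ * _),
      add_zero] at this
    · rw [← this]
      simp [hF]
    · intro k _
      by_cases hk : R 0 k.succ
      · rw [hF' k hk, mul_zero]
      · rw [hs.1 _ _ hk, zero_mul]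
  have c2 : ∀ s ∈ incStab R F, ∀ w : Fin N, R 0 w.succ → s w.succ 0 = 0 := by
    intro s hs w hw
    have := hs.2 q.succ w.succ (htrans _ _ _ hq hw)
    rw [Matrix.mul_apply, Matrix.mul_apply, Fin.sum_univ_succ, Fin.sum_univ_succ,
      hs.1 _ _ hq', mul_zero, zero_add, hF, if_pos rfl, mul_one,
      col' s hs.1 (fun k => F w.succ k.succ), hF' w hw, zero_mul,
      Finset.sum_eq_zero, add_zero] at this
    · exact this.symm
    · intro k _
      by_cases hk : R w.succ k.succ
      · rw [hF' k (hXY _ _ hk hw), mul_zero]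
      · rw [hs.1 _ _ hk, zero_mul]
  have c0 : ∀ s ∈ incStab R F, ∀ w : Fin N, w ≠ q → s w.succ 0 = 0 := by
    intro s hs w hw
    by_cases hw' : R w.succ 0
    · exact c2 s hs w ((h3 w hw').resolve_left hw)
    · exact hs.1 _ _ hw'
  have c4 : ∀ s ∈ incStab R F, s q.succ 0 = ∑ k : Fin N, s 0 k.succ * F k.succ 0 := by
    intro s hs
    have := hs.2 _ _ (hrefl 0)
    rw [Matrix.mul_apply, Matrix.mul_apply, Fin.sum_univ_succ, Fin.sum_univ_succ, hF0, mul_zero,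
      zero_mul, zero_add, zero_add] at this
    rw [← this]
    simp [hF]
  have c6 : ∀ s ∈ incStab R F, ∀ w : Fin N, R 0 w.succ →
      s q.succ w.succ = ∑ k : Fin N, s 0 k.succ * F k.succ w.succ := by
    intro s hs w hw
    have := hs.2 _ _ (h1 w hw)
    rw [Matrix.mul_apply, Matrix.mul_apply, Fin.sum_univ_succ, Fin.sum_univ_succ, hF0,
      zero_mul, zero_add, hF, if_neg (hneq w hw), mul_zero, zero_add] at this
    rw [← this]
    simp [hF]
  have q1 : ∀ (s : Matrix (Fin (N + 1)) (Fin (N + 1)) D) (i j : Fin N), ¬ (i = q ∧ R 0 j.succ) →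
      twinSubmatrix D R q s i j = s i.succ j.succ := fun s i j h => if_neg h
  have q2 : ∀ (s : Matrix (Fin (N + 1)) (Fin (N + 1)) D) (j : Fin N), R 0 j.succ →
      twinSubmatrix D R q s q j = s 0 j.succ := fun s j h => if_pos ⟨rfl, h⟩
  have f1 : ∀ i j : Fin N, ¬ (j = q ∧ R 0 i.succ) → twinForm R q F i j = F i.succ j.succ :=
    fun i j h => if_neg h
  have f2 : ∀ i : Fin N, R 0 i.succ → twinForm R q F i q = F i.succ 0 :=
    fun i h => if_pos ⟨rfl, h⟩
  have qsupp : ∀ s : Matrix (Fin (N + 1)) (Fin (N + 1)) D, (∀ i j, ¬ R i j → s i j = 0) →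
      ∀ i j : Fin N, ¬ R i.succ j.succ → twinSubmatrix D R q s i j = 0 := by
    intro s hs i j h
    by_cases h' : i = q ∧ R 0 j.succ
    · rw [h'.1] at h
      exact absurd (htrans _ _ _ hq h'.2) h
    · rw [q1 s i j h', hs _ _ h]
  -- the two systems of equations agree termwise
  have qmul : ∀ s : Matrix (Fin (N + 1)) (Fin (N + 1)) D, (∀ i j, ¬ R i j → s i j = 0) →
      (∀ w : Fin N, w ≠ q → s w.succ 0 = 0) → ∀ i j : Fin N, R i.succ j.succ → i ≠ q →
      ((twinForm R q F * twinSubmatrix D R q s) j i = (F * s) j.succ i.succ ∧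
        (twinSubmatrix D R q s * twinForm R q F) j i = (s * F) j.succ i.succ) := by
    intro s hs hs0 i j hij hi
    have hj : j ≠ q := fun h => hi (h4 i (h ▸ hij))
    rw [Matrix.mul_apply, Matrix.mul_apply, Matrix.mul_apply, Matrix.mul_apply,
      Fin.sum_univ_succ (fun k => F j.succ k * _), Fin.sum_univ_succ (fun k => s j.succ k * _),
      hs0 j hj, zero_mul, zero_add]
    constructor
    · by_cases hXi : R 0 i.succ
      · have hXj := hXY _ _ hij hXi
        rw [← Finset.add_sum_erase _ _ (Finset.mem_univ q),
          ← Finset.add_sum_erase _ (fun k : Fin N => F j.succ k.succ * _) (Finset.mem_univ q),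
          f2 j hXj, q2 s i hXi, hF' j hXj, zero_mul, zero_add]
        congr 1
        refine Finset.sum_congr rfl fun k hk => ?_
        have hk' := Finset.ne_of_mem_erase hk
        rw [f1 j k fun h => hk' h.1, q1 s k i fun h => hk' h.1]
      · have hXj : ¬ R 0 j.succ := fun h => hXi (hYX _ _ hi hij h)
        rw [hs _ _ hXi, mul_zero, zero_add]
        refine Finset.sum_congr rfl fun k hk => ?_
        rw [f1 j k fun h => hXj h.2, q1 s k i fun h => hXi h.2]
    · refine Finset.sum_congr rfl fun k hk => ?_
      rw [f1 k i fun h => hi h.1, q1 s j k fun h => hj h.1]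
  have qmulq : ∀ s : Matrix (Fin (N + 1)) (Fin (N + 1)) D, (∀ i j, ¬ R i j → s i j = 0) →
      ∀ j : Fin N, j ≠ q → ¬ R 0 j.succ →
      ((twinForm R q F * twinSubmatrix D R q s) j q = (F * s) j.succ q.succ ∧
        (twinSubmatrix D R q s * twinForm R q F) j q = (s * F) j.succ q.succ) := by
    intro s hs j hj hXj
    have hj0 : ¬ R j.succ 0 := fun h => hXj ((h3 j h).resolve_left hj)
    rw [Matrix.mul_apply, Matrix.mul_apply, Matrix.mul_apply, Matrix.mul_apply,
      Fin.sum_univ_succ (fun k => F j.succ k * _), Fin.sum_univ_succ (fun k => s j.succ k * _),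
      hs _ _ hj0, hs _ _ hq', mul_zero, zero_mul, zero_add, zero_add]
    constructor
    · refine Finset.sum_congr rfl fun k hk => ?_
      rw [f1 j k fun h => hXj h.2, q1 s k q fun h => hq' h.2]
    · refine Finset.sum_congr rfl fun k hk => ?_
      rw [q1 s j k fun h => hj h.1]
      by_cases hXk : R 0 k.succ
      · rw [hs _ _ fun h => hXj (hYX _ _ hj h hXk), zero_mul, zero_mul]
      · rw [f1 k q fun h => hXk h.2]
  have qX : ∀ s : Matrix (Fin (N + 1)) (Fin (N + 1)) D, (∀ i j, ¬ R i j → s i j = 0) →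
      (∀ w : Fin N, w ≠ q → s w.succ 0 = 0) → s 0 0 = s q.succ q.succ →
      ∀ j : Fin N, R 0 j.succ →
      ((twinForm R q F * twinSubmatrix D R q s) j q = (F * s) j.succ 0 ∧
        (twinSubmatrix D R q s * twinForm R q F) j q = (s * F) j.succ 0) := by
    intro s hs hs0 hs00 j hXj
    have hj := hneq j hXj
    rw [Matrix.mul_apply, col _ (qsupp s hs), f2 j hXj, q1 s q q fun h => hq' h.2,
      Matrix.mul_apply, Matrix.mul_apply, Matrix.mul_apply, Fin.sum_univ_succ,
      Fin.sum_univ_succ (fun k => s j.succ k * _), hF0, mul_zero, zero_add, hs00]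
    constructor
    · rw [Finset.sum_eq_zero, add_zero]
      intro k _
      by_cases hk : k = q
      · rw [hk, hF' j hXj, zero_mul]
      · rw [hs0 k hk, mul_zero]
    · refine Finset.sum_congr rfl fun k hk => ?_
      rw [q1 s j k fun h => hj h.1]
      by_cases hXk : R 0 k.succ
      · rw [f2 k hXk]
      · rw [hs _ _ fun h => hXk (hXY _ _ h hXj), zero_mul, zero_mul]
  have qq : ∀ s : Matrix (Fin (N + 1)) (Fin (N + 1)) D, (∀ i j, ¬ R i j → s i j = 0) →
      s q.succ 0 = ∑ k : Fin N, s 0 k.succ * F k.succ 0 →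
      ((twinForm R q F * twinSubmatrix D R q s) q q = (F * s) q.succ q.succ ∧
        (twinSubmatrix D R q s * twinForm R q F) q q = (s * F) q.succ q.succ) := by
    intro s hs hs0
    rw [Matrix.mul_apply, col _ (qsupp s hs), f1 q q fun h => hq' h.2, q1 s q q fun h => hq' h.2,
      Matrix.mul_apply, Matrix.mul_apply, Matrix.mul_apply, Fin.sum_univ_succ,
      Fin.sum_univ_succ (fun k => s q.succ k * _), hs _ _ hq', mul_zero, zero_add,
      col' s hs (fun k => F q.succ k.succ), hF, if_pos rfl, mul_one, hs0]
    refine ⟨rfl, ?_⟩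
    rw [← Finset.sum_add_distrib]
    refine Finset.sum_congr rfl fun k hk => ?_
    by_cases hXk : R 0 k.succ
    · rw [f2 k hXk, q2 s k hXk, hF' k hXk, mul_zero, add_zero]
    · rw [f1 k q fun h => hXk h.2, q1 s q k fun h => hXk h.2, hs _ _ hXk, zero_mul, zero_add]
  refine finrank_eq_of_map (twinSubmatrix D R q) ?_ ?_ ?_
  · intro s hs
    refine ⟨qsupp s hs.1, fun i j hij => ?_⟩
    by_cases hi : i = q
    · subst hi
      by_cases hj : j = i
      · subst hj
        obtain ⟨e1, e2⟩ := qq s hs.1 (c4 s hs)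
        rw [e1, e2, hs.2 _ _ hij]
      · by_cases hXj : R 0 j.succ
        · obtain ⟨e1, e2⟩ := qX s hs.1 (c0 s hs) (c1 s hs) j hXj
          rw [e1, e2, hs.2 _ _ hXj]
        · obtain ⟨e1, e2⟩ := qmulq s hs.1 j hj hXj
          rw [e1, e2, hs.2 _ _ hij]
    · obtain ⟨e1, e2⟩ := qmul s hs.1 (c0 s hs) i j hij hi
      rw [e1, e2, hs.2 _ _ hij]
  · intro s hs h
    have g0 : ∀ j : Fin N, s 0 j.succ = 0 := by
      intro j
      by_cases hj : R 0 j.succ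
      · rw [← q2 s j hj, h, Matrix.zero_apply]
      · exact hs.1 _ _ hj
    have gq : s q.succ q.succ = 0 := by rw [← q1 s q q fun h => hq' h.2, h, Matrix.zero_apply]
    ext i j
    refine Fin.cases ?_ (fun i => ?_) i
    · refine Fin.cases ?_ (fun j => g0 j) j
      rw [c1 s hs, gq, Matrix.zero_apply]
    · refine Fin.cases ?_ (fun j => ?_) j
      · by_cases hi : i = q
        · rw [hi, c4 s hs]
          simp [g0]
        · exact c0 s hs i hi
      · by_cases hij : i = q ∧ R 0 j.succ
        · rw [hij.1, c6 s hs j hij.2]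
          simp [g0]
        · rw [← q1 s i j hij, h, Matrix.zero_apply, Matrix.zero_apply]
  · intro s hs
    set t0 : Fin N → D := fun j => if R 0 j.succ then s q j else 0 with ht0
    -- Row `q` of `s` over `X` moves to row `0`; the vacated entries of row `q`, and the entry from
    -- `q` to `0`, are filled in by `c4` and `c6`.
    set t : Matrix (Fin (N + 1)) (Fin (N + 1)) D := Matrix.of fun i j =>
      Fin.cases (Fin.cases (s q q) t0 j) (fun i => Fin.cases
        (if i = q then ∑ k : Fin N, t0 k * F k.succ 0 else 0)
        (fun j => if i = q ∧ R 0 j.succ then ∑ k : Fin N, t0 k * F k.succ j.succ else s i j) j) i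
      with ht
    have t00 : t 0 0 = s q q := rfl
    have t0' : ∀ j : Fin N, t 0 j.succ = if R 0 j.succ then s q j else 0 := fun _ => rfl
    have tq0 : t q.succ 0 = ∑ k : Fin N, t 0 k.succ * F k.succ 0 := if_pos rfl
    have ti0 : ∀ i : Fin N, i ≠ q → t i.succ 0 = 0 := fun i hi => if_neg hi
    have tqX : ∀ j : Fin N, R 0 j.succ →
      t q.succ j.succ = ∑ k : Fin N, t 0 k.succ * F k.succ j.succ := fun j h => if_pos ⟨rfl, h⟩
    have tij : ∀ i j : Fin N, ¬ (i = q ∧ R 0 j.succ) → t i.succ j.succ = s i j :=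
      fun i j h => if_neg h
    have tqq : t q.succ q.succ = s q q := tij q q fun h => hq' h.2
    have hφ : twinSubmatrix D R q t = s := by
      ext i j
      by_cases h : i = q ∧ R 0 j.succ
      · rw [h.1, q2 t j h.2, t0', if_pos h.2]
      · rw [q1 t i j h, tij i j h]
    have tR : ∀ i j, ¬ R i j → t i j = 0 := by
      intro i j
      refine Fin.cases ?_ (fun i => ?_) i
      · refine Fin.cases ?_ (fun j => ?_) j
        · exact fun h => absurd (hrefl 0) h
        · exact fun h => if_neg h
      · refine Fin.cases ?_ (fun j => ?_) j
        · exact fun h => ti0 i fun h' => h (h' ▸ hq)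
        · intro h
          rw [tij i j fun h' => h (h'.1 ▸ htrans _ _ _ hq h'.2), hs.1 _ _ h]
    refine ⟨t, ⟨tR, ?_⟩, hφ⟩
    intro i j
    refine Fin.cases ?_ (fun i => ?_) i
    · refine Fin.cases ?_ (fun j => ?_) j
      · intro _
        rw [Matrix.mul_apply, Matrix.mul_apply, Fin.sum_univ_succ, Fin.sum_univ_succ, hF0, ← tq0]
        simp [hF]
      · intro hXj
        obtain ⟨e1, e2⟩ := qX t tR ti0 (t00.trans tqq.symm) j hXj
        rw [← e1, ← e2, hφ]
        exact hs.2 _ _ (htrans _ _ _ hq hXj)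
    · refine Fin.cases ?_ (fun j => ?_) j
      · intro hi
        rw [Matrix.mul_apply, Matrix.mul_apply, Fin.sum_univ_succ, Fin.sum_univ_succ, hF0, hF]
        by_cases hiq : i = q
        · subst hiq
          rw [Finset.sum_eq_zero (f := fun k : Fin N => t 0 k.succ * _)]
          · simp [hF, tqq, t00]
          · intro k _
            by_cases hk : R 0 k.succ
            · rw [hF' k hk, mul_zero]
            · rw [tR _ _ hk, zero_mul]
        · have hXi := (h3 i hi).resolve_left hiq
          rw [← tqX i hXi]
          simp [hF, hiq]
      · intro hij
        by_cases hi : i = q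
        · subst hi
          by_cases hj : j = i
          · subst hj
            obtain ⟨e1, e2⟩ := qq t tR tq0
            rw [← e1, ← e2, hφ, hs.2 _ _ hij]
          · by_cases hXj : R 0 j.succ
            · rw [Matrix.mul_apply, Matrix.mul_apply, Fin.sum_univ_succ, Fin.sum_univ_succ,
                tR _ _ hq', ti0 j hj, mul_zero, zero_mul,
                col' t tR (fun k => F j.succ k.succ), hF' j hXj,
                zero_mul, Finset.sum_eq_zero]
              intro k _
              by_cases hk : R j.succ k.succ
              · rw [hF' k (hXY _ _ hk hXj), mul_zero]
              · rw [tR _ _ hk, zero_mul]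
            · obtain ⟨e1, e2⟩ := qmulq t tR j hj hXj
              rw [← e1, ← e2, hφ, hs.2 _ _ hij]
        · obtain ⟨e1, e2⟩ := qmul t tR ti0 i j hij hi
          rw [← e1, ← e2, hφ, hs.2 _ _ hij]

end RemovalTwin

/-! ### Normal forms of linear forms under conjugation -/

section Normalization

variable {ι D : Type} [Fintype ι] [DecidableEq ι] [Ring D] [Algebra ℂ D]

theorem finrank_incStab_transvection {R : ι → ι → Prop} (hrefl : ∀ i, R i i)
    (htrans : ∀ i j k, R i j → R j k → R i k) {T : Matrix ι ι D}
    (hT : ∀ i j, ¬ R i j → T i j = 0) (hTT : T * T = 0) (F : Matrix ι ι D) :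
    finrank ℂ (incStab R ((1 - T) * F * (1 + T))) = finrank ℂ (incStab R F) := by
  have hone : ∀ i j, ¬ R i j → (1 : Matrix ι ι D) i j = 0 :=
    fun i j h => Matrix.one_apply_ne fun h' => h (h' ▸ hrefl i)
  refine finrank_incStab_conj htrans (fun i j h => ?_) (fun i j h => ?_) ?_ ?_ F
  · rw [Matrix.sub_apply, hone i j h, hT i j h, sub_zero]
  · rw [Matrix.add_apply, hone i j h, hT i j h, add_zero]
  · rw [sub_mul, one_mul, mul_add, mul_one, hTT, add_zero, add_sub_cancel_right]
  · rw [add_mul, one_mul, mul_sub, mul_one, hTT, sub_zero, sub_add_cancel]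

theorem finrank_incStab_diagonal {R : ι → ι → Prop} (hrefl : ∀ i, R i i)
    (htrans : ∀ i j k, R i j → R j k → R i k) {d e : ι → D} (hde : ∀ i, d i * e i = 1)
    (hed : ∀ i, e i * d i = 1) (F : Matrix ι ι D) :
    finrank ℂ (incStab R (Matrix.diagonal d * F * Matrix.diagonal e)) =
      finrank ℂ (incStab R F) := by
  have hdiag : ∀ (d : ι → D) (i j), ¬ R i j → Matrix.diagonal d i j = 0 :=
    fun d i j h => Matrix.diagonal_apply_ne _ fun h' => h (h' ▸ hrefl i)
  refine finrank_incStab_conj htrans (hdiag d) (hdiag e) ?_ ?_ F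
  · rw [Matrix.diagonal_mul_diagonal]
    simp [hde]
  · rw [Matrix.diagonal_mul_diagonal]
    simp [hed]

/-- Rescaling only the node `p` divides row `p` by the invertible entry from the left. The inverse
factor on the right acts on column `p`, which is not column `q`. -/
theorem exists_incStab_entry_eq_one {R : ι → ι → Prop} (hrefl : ∀ i, R i i)
    (htrans : ∀ i j k, R i j → R j k → R i k) {p q : ι} (hpq : q ≠ p) (F : Matrix ι ι D)
    (hF : IsUnit (F p q)) :
    ∃ G : Matrix ι ι D, finrank ℂ (incStab R G) = finrank ℂ (incStab R F) ∧ G p q = 1 := by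
  obtain ⟨b, hb⟩ := hF
  refine ⟨_, finrank_incStab_diagonal hrefl htrans (d := Function.update 1 p (↑b⁻¹ : D))
    (e := Function.update 1 p (b : D)) ?_ ?_ F, ?_⟩
  · intro i
    by_cases hi : i = p
    · subst hi; simp
    · simp [hi]
  · intro i
    by_cases hi : i = p
    · subst hi; simp
    · simp [hi]
  · rw [Matrix.mul_diagonal, Matrix.diagonal_mul, ← hb]
    simp [hpq]

/-- Column operations with the pivot `F p q = 1` clear row `p`. The matrix `T` lives in row `q`, so
the left factor changes only row `q`; the right factor leaves column `q` alone. The last clause thus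
preserves a column `q` that was cleared before. The hypothesis `hq` puts `T` inside the algebra. -/
theorem exists_incStab_row_normal {R : ι → ι → Prop} (hrefl : ∀ i, R i i)
    (htrans : ∀ i j k, R i j → R j k → R i k) {p q : ι} (hpq : q ≠ p)
    (hq : ∀ k, R k p → R q k) (F : Matrix ι ι D) (hF : F p q = 1) :
    ∃ G : Matrix ι ι D, finrank ℂ (incStab R G) = finrank ℂ (incStab R F) ∧
      (∀ k, R k p → G p k = if k = q then 1 else 0) ∧ ∀ k, k ≠ q → G k q = F k q := by
  classical
  set T : Matrix ι ι D := Matrix.of fun i k => if i = q ∧ k ≠ q ∧ R k p then - F p k else 0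
    with hTdef
  have hT : ∀ i j, ¬ (i = q ∧ j ≠ q ∧ R j p) → T i j = 0 := fun i j h => if_neg h
  have hrow : ∀ (M : Matrix ι ι D) i j, i ≠ q → (T * M) i j = 0 := by
    intro M i j hi
    rw [Matrix.mul_apply]
    exact Finset.sum_eq_zero fun k _ => by rw [hT i k fun h => hi h.1, zero_mul]
  have hcol : ∀ (M : Matrix ι ι D) i j, (M * T) i j = M i q * T q j := by
    intro M i j
    rw [Matrix.mul_apply]
    refine Finset.sum_eq_single q (fun k _ hk => ?_) (fun h => absurd (Finset.mem_univ _) h)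
    rw [hT k j fun h => hk h.1, mul_zero]
  have hTq : ∀ i, T i q = 0 := fun i => hT i q fun h => h.2.1 rfl
  refine ⟨(1 - T) * F * (1 + T), finrank_incStab_transvection hrefl htrans ?_ ?_ F, ?_, ?_⟩
  · intro i j h
    exact hT i j fun h' => h (h'.1 ▸ hq j h'.2.2)
  · ext i j
    rw [hcol, hTq, zero_mul, Matrix.zero_apply]
  · intro k hk
    rw [mul_add, mul_one, Matrix.add_apply, hcol, sub_mul, one_mul, Matrix.sub_apply,
      Matrix.sub_apply, hrow F p _ hpq.symm, hrow F p _ hpq.symm, hF]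
    by_cases hkq : k = q
    · rw [hkq, hTq, hF]; simp
    · have : T q k = - F p k := if_pos ⟨rfl, hkq, hk⟩
      rw [this]; simp [hkq]
  · intro k hk
    rw [mul_add, mul_one, Matrix.add_apply, hcol, hTq, sub_mul, one_mul, Matrix.sub_apply,
      hrow F k _ hk]
    simp

/-- Row operations with the pivot `F p q = 1` clear column `q` over the nodes that `p` reaches. Now
`T` lives in column `p`, and it lies in the algebra because those nodes reach `p` in turn. -/
theorem exists_incStab_col_normal {R : ι → ι → Prop} (hrefl : ∀ i, R i i)
    (htrans : ∀ i j k, R i j → R j k → R i k) {p q : ι} (hpq : q ≠ p)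
    (hp : ∀ k, R p k → R k p) (F : Matrix ι ι D) (hF : F p q = 1) :
    ∃ G : Matrix ι ι D, finrank ℂ (incStab R G) = finrank ℂ (incStab R F) ∧
      G p q = 1 ∧ ∀ k, k ≠ p → R p k → G k q = 0 := by
  classical
  set T : Matrix ι ι D := Matrix.of fun i k => if k = p ∧ i ≠ p ∧ R p i then F i q else 0
    with hTdef
  have hT : ∀ i j, ¬ (j = p ∧ i ≠ p ∧ R p i) → T i j = 0 := fun i j h => if_neg h
  have hrow : ∀ (M : Matrix ι ι D) i j, (T * M) i j = T i p * M p j := by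
    intro M i j
    rw [Matrix.mul_apply]
    refine Finset.sum_eq_single p (fun k _ hk => ?_) (fun h => absurd (Finset.mem_univ _) h)
    rw [hT i k fun h => hk h.1, zero_mul]
  have hcol : ∀ (M : Matrix ι ι D) i j, j ≠ p → (M * T) i j = 0 := by
    intro M i j hj
    rw [Matrix.mul_apply]
    exact Finset.sum_eq_zero fun k _ => by rw [hT k j fun h => hj h.1, mul_zero]
  have hTp : ∀ i, T p i = 0 := fun i => hT p i fun h => h.2.1 rfl
  refine ⟨(1 - T) * F * (1 + T), finrank_incStab_transvection hrefl htrans ?_ ?_ F, ?_, ?_⟩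
  · intro i j h
    exact hT i j fun h' => h (h'.1 ▸ hp i h'.2.2)
  · ext i j
    rw [hrow, hTp, mul_zero, Matrix.zero_apply]
  · rw [mul_add, mul_one, Matrix.add_apply, hcol _ _ _ hpq, sub_mul, one_mul, Matrix.sub_apply,
      hrow, hTp, hF]
    simp
  · intro k hk hk'
    have : T k p = F k q := if_pos ⟨rfl, hk, hk'⟩
    rw [mul_add, mul_one, Matrix.add_apply, hcol _ _ _ hpq, sub_mul, one_mul, Matrix.sub_apply,
      hrow, this, hF]
    simp

/-- Move an optimal form along the line on which its `(p, q)` entry tends to the identity at `t =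
1`. Almost every `t` keeps the stabilizer minimal and makes that entry invertible. -/
theorem exists_incStab_entry_isUnit {κ : Type} [Fintype κ] [DecidableEq κ] (R : ι → ι → Prop)
    (p q : ι) : ∃ F : Matrix ι ι (Matrix κ κ ℂ),
      finrank ℂ (incStab R F) ≤ incIndex (Matrix κ κ ℂ) R ∧ IsUnit (F p q) := by
  obtain ⟨F, hF⟩ := exists_finrank_incStab_eq (Matrix κ κ ℂ) R
  have h1 := eventually_finrank_incStab_add_smul_le R F (Matrix.single p q (1 - F p q))
  have h2 := Matrix.eventually_det_add_smul_ne_zero (F p q) (1 - F p q) 1 (by simp)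
  obtain ⟨t, ht1, ht2⟩ := (h1.and h2).exists
  refine ⟨_, ht1.trans hF.le, ?_⟩
  rw [Matrix.isUnit_iff_isUnit_det, isUnit_iff_ne_zero]
  simpa using ht2

end Normalization

/-! ### The index after removal of a node -/

section IndexRemoval

variable {κ : Type} [Fintype κ] [DecidableEq κ] {N : ℕ}

/-- Removal of a node `0` that reaches no other node. -/
theorem incIndex_removeLeaf {R : Fin (N + 1) → Fin (N + 1) → Prop} (hrefl : ∀ i, R i i)
    (htrans : ∀ i j k, R i j → R j k → R i k) {q : Fin N} (h0 : ∀ j : Fin N, ¬ R 0 j.succ)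
    (hq : R q.succ 0) (hq' : ∀ i : Fin N, R i.succ 0 → R q.succ i.succ) :
    incIndex (Matrix κ κ ℂ) R = incIndex (Matrix κ κ ℂ) (removeLeaf R q) := by
  have hq'' : ∀ k, R k 0 → R q.succ k := by
    intro k
    refine Fin.cases (fun _ => hq) (fun k => hq' k) k
  apply le_antisymm
  · obtain ⟨F, hF⟩ := exists_finrank_incStab_eq (Matrix κ κ ℂ) (removeLeaf R q)
    -- An optimal form on the smaller node set is extended in normal form, with corner `0` so that
    -- no correction at `(q, q)` appears.
    set G : Matrix (Fin (N + 1)) (Fin (N + 1)) (Matrix κ κ ℂ) := Matrix.of fun i j =>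
      Fin.cases (Fin.cases 0 (fun j => if j = q then 1 else 0) j)
        (fun i => Fin.cases 0 (fun j => F i j) j) i
    have := finrank_incStab_removeLeaf hrefl htrans h0 hq hq' G (fun _ => rfl) (fun _ => rfl)
    have hG : succSubmatrix (Matrix κ κ ℂ) N G + Matrix.single q q (G 0 0) = F := by
      have : G 0 0 = 0 := rfl
      rw [this, Matrix.single_zero, add_zero]
      rfl
    rw [hG, hF] at this
    exact this ▸ incIndex_le R G
  · obtain ⟨F, hF, hu⟩ := exists_incStab_entry_isUnit (κ := κ) R 0 q.succ
    obtain ⟨F1, hF1, h1⟩ := exists_incStab_entry_eq_one hrefl htrans (Fin.succ_ne_zero q) F hu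
    obtain ⟨F2, hF2, h2, -⟩ :=
      exists_incStab_row_normal hrefl htrans (Fin.succ_ne_zero q) hq'' F1 h1
    set G : Matrix (Fin (N + 1)) (Fin (N + 1)) (Matrix κ κ ℂ) := Matrix.of fun i j =>
      Fin.cases (Fin.cases 0 (fun j => if j = q then 1 else 0) j)
        (fun i => Fin.cases 0 (fun j => F2 i.succ j.succ) j) i
    have h3 := finrank_incStab_removeLeaf hrefl htrans h0 hq hq' G (fun _ => rfl) (fun _ => rfl)
    -- The two forms differ only in entries that do not pair with the incidence algebra.
    have h4 : incStab R F2 = incStab R G := by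
      refine incStab_congr htrans fun i j => ?_
      refine Fin.cases ?_ (fun i => ?_) i
      · refine Fin.cases (fun h => ?_) (fun j h => absurd h (h0 j)) j
        rw [h2 0 h, if_neg (Fin.succ_ne_zero q).symm]
        rfl
      · refine Fin.cases (fun h => ?_) (fun j h => rfl) j
        rw [h2 _ h]
        simp [G]
    rw [← h4, hF2, hF1] at h3
    exact (incIndex_le _ _).trans (h3 ▸ hF)

/-- Removal of a node `0` that reaches only the nodes equivalent to it. -/
theorem incIndex_removeTwin {R : Fin (N + 1) → Fin (N + 1) → Prop} (hrefl : ∀ i, R i i)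
    (htrans : ∀ i j k, R i j → R j k → R i k) {q : Fin N}
    (h1 : ∀ w : Fin N, R 0 w.succ → R w.succ 0) (hq : R q.succ 0) (hq' : ¬ R 0 q.succ)
    (h3 : ∀ i : Fin N, R i.succ 0 → i = q ∨ R 0 i.succ)
    (h4 : ∀ i : Fin N, R i.succ q.succ → i = q) :
    incIndex (Matrix κ κ ℂ) R =
      incIndex (Matrix κ κ ℂ) (fun i j : Fin N => R i.succ j.succ) := by
  classical
  have hq'' : ∀ k, R k 0 → R q.succ k := by
    intro k
    refine Fin.cases (fun _ => hq) (fun k hk => ?_) k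
    rcases h3 k hk with rfl | h
    · exact hrefl _
    · exact htrans _ _ _ hq h
  have h1' : ∀ k, R 0 k → R k 0 := by
    intro k
    exact Fin.cases (fun h => h) h1 k
  apply le_antisymm
  · obtain ⟨F, hF⟩ := exists_finrank_incStab_eq (Matrix κ κ ℂ)
      (fun i j : Fin N => R i.succ j.succ)
    set G : Matrix (Fin (N + 1)) (Fin (N + 1)) (Matrix κ κ ℂ) := Matrix.of fun i j =>
      Fin.cases (Fin.cases 0 (fun j => if j = q then 1 else 0) j)
        (fun i => Fin.cases (F i q) (fun j => if j = q ∧ R 0 i.succ then 0 else F i j) j) i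
    have := finrank_incStab_removeTwin hrefl htrans h1 hq hq' h3 h4 G rfl (fun _ => rfl)
      (fun j h => if_pos ⟨rfl, h⟩)
    have hG : twinForm R q G = F := by
      ext1 i j
      by_cases h : j = q ∧ R 0 i.succ
      · rw [h.1]
        exact if_pos ⟨rfl, h.2⟩
      · exact (if_neg h).trans (if_neg h)
    rw [hG, hF] at this
    exact this ▸ incIndex_le R G
  · obtain ⟨F, hF, hu⟩ := exists_incStab_entry_isUnit (κ := κ) R 0 q.succ
    obtain ⟨F1, hF1, e1⟩ := exists_incStab_entry_eq_one hrefl htrans (Fin.succ_ne_zero q) F hu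
    -- The column is cleared before the row, since the row step leaves column `q` intact outside row
    -- `q`.
    obtain ⟨F2, hF2, e2, e2'⟩ :=
      exists_incStab_col_normal hrefl htrans (Fin.succ_ne_zero q) h1' F1 e1
    obtain ⟨F3, hF3, e3, e3'⟩ :=
      exists_incStab_row_normal hrefl htrans (Fin.succ_ne_zero q) hq'' F2 e2
    set G : Matrix (Fin (N + 1)) (Fin (N + 1)) (Matrix κ κ ℂ) := Matrix.of fun i j =>
      Fin.cases (Fin.cases 0 (fun j => if j = q then 1 else 0) j) (fun i => F3 i.succ j) i
    have h5 : incStab R F3 = incStab R G := by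
      refine incStab_congr htrans fun i j => ?_
      refine Fin.cases ?_ (fun j => ?_) j
      · refine Fin.cases (fun h => ?_) (fun i h => ?_) i
        · rw [e3 0 h, if_neg (Fin.succ_ne_zero q).symm]
          rfl
        · rw [e3 _ h]
          simp [G]
      · exact fun _ => rfl
    have h6 := finrank_incStab_removeTwin hrefl htrans h1 hq hq' h3 h4 G rfl (fun _ => rfl)
      (fun j h => (e3' _ fun h' => hq' (h' ▸ h)).trans (e2' _ (Fin.succ_ne_zero j) h))
    rw [← h5, hF3, hF2, hF1] at h6
    exact (incIndex_le _ _).trans (h6 ▸ hF)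

end IndexRemoval

/-! ### Reversal, relabelling, matrix coefficients and disjoint unions -/

section Transport

theorem finrank_submodule_prod {V W : Type*} [AddCommGroup V] [Module ℂ V]
    [FiniteDimensional ℂ V] [AddCommGroup W] [Module ℂ W] [FiniteDimensional ℂ W]
    (p : Submodule ℂ V) (q : Submodule ℂ W) :
    finrank ℂ (p.prod q) = finrank ℂ p + finrank ℂ q := by
  rw [← finrank_prod]
  exact LinearEquiv.finrank_eq
    { toFun := fun x => (⟨x.1.1, x.2.1⟩, ⟨x.1.2, x.2.2⟩)
      invFun := fun x => ⟨(x.1.1, x.2.1), x.1.2, x.2.2⟩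
      map_add' := fun _ _ => rfl
      map_smul' := fun _ _ => rfl }

/-- Full transposition is an anti-automorphism. The coefficients do not commute, so they have to be
transposed along with the positions. -/
theorem incIndex_swap_le {ι κ : Type} [Fintype ι] [Fintype κ] [DecidableEq κ]
    (R : ι → ι → Prop) :
    incIndex (Matrix κ κ ℂ) R ≤ incIndex (Matrix κ κ ℂ) (fun i j => R j i) := by
  let τ : Matrix ι ι (Matrix κ κ ℂ) →ₗ[ℂ] Matrix ι ι (Matrix κ κ ℂ) :=
    { toFun := fun s => Matrix.of fun i j => (s j i).transpose
      map_add' := fun _ _ => rfl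
      map_smul' := fun _ _ => rfl }
  have hτ : ∀ s i j, τ s i j = (s j i).transpose := fun _ _ _ => rfl
  have hmul : ∀ a b i j, (τ a * τ b) i j = ((b * a) j i).transpose := by
    intro a b i j
    rw [Matrix.mul_apply, Matrix.mul_apply, Matrix.transpose_sum]
    exact Finset.sum_congr rfl fun k _ => by rw [hτ, hτ, Matrix.transpose_mul]
  obtain ⟨F, hF⟩ := exists_finrank_incStab_eq (Matrix κ κ ℂ) (fun i j => R j i)
  rw [← hF]
  refine (incIndex_le R (τ F)).trans (finrank_le_of_injOn τ ?_ ?_)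
  · rintro s ⟨hs, hs'⟩
    refine ⟨fun i j h => ?_, fun i j h => ?_⟩
    · rw [hτ, hs j i h, Matrix.transpose_zero]
    · have := hs' j i h
      have h1 := hmul s (τ F) j i
      have h2 := hmul (τ F) s j i
      have h3 : τ (τ F) = F := rfl
      rw [h3] at h1 h2
      rw [h1, h2, this]
  · intro s _ h
    ext1 i j
    have := congrFun (congrFun h j) i
    rw [hτ] at this
    exact Matrix.transpose_eq_zero.mp this

/-- The index does not change when the relation is reversed. -/
theorem incIndex_swap {ι κ : Type} [Fintype ι] [Fintype κ] [DecidableEq κ] (R : ι → ι → Prop) :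
    incIndex (Matrix κ κ ℂ) (fun i j => R j i) = incIndex (Matrix κ κ ℂ) R :=
  le_antisymm (incIndex_swap_le fun i j => R j i) (incIndex_swap_le R)

variable {D : Type} [Ring D] [Algebra ℂ D] [FiniteDimensional ℂ D]

theorem incIndex_le_of_equiv {ι ι' : Type} [Fintype ι] [Fintype ι'] (σ : ι ≃ ι')
    {R : ι → ι → Prop} {R' : ι' → ι' → Prop} (h : ∀ i j, R i j ↔ R' (σ i) (σ j)) :
    incIndex D R ≤ incIndex D R' := by
  obtain ⟨F, hF⟩ := exists_finrank_incStab_eq D R'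
  rw [← hF]
  refine (incIndex_le R (F.submatrix σ σ)).trans
    (finrank_le_of_injOn (Matrix.reindexLinearEquiv ℂ D σ σ).toLinearMap ?_ ?_)
  · rintro s ⟨hs, hs'⟩
    have h' : ∀ i j, R' i j ↔ R (σ.symm i) (σ.symm j) := by simp [h]
    have e : (Matrix.reindexLinearEquiv ℂ D σ σ).toLinearMap s = s.submatrix σ.symm σ.symm := rfl
    have eF : F = (F.submatrix σ σ).submatrix σ.symm σ.symm := by simp
    rw [e]
    refine ⟨fun i j hij => hs _ _ ((h' i j).not.mp hij), fun i j hij => ?_⟩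
    rw [eF, Matrix.submatrix_mul_equiv, Matrix.submatrix_mul_equiv]
    exact hs' _ _ ((h' i j).mp hij)
  · intro s _ hs
    exact (LinearEquiv.map_eq_zero_iff _).mp hs

theorem incIndex_congr {ι ι' : Type} [Fintype ι] [Fintype ι'] (σ : ι ≃ ι')
    {R : ι → ι → Prop} {R' : ι' → ι' → Prop} (h : ∀ i j, R i j ↔ R' (σ i) (σ j)) :
    incIndex D R = incIndex D R' :=
  le_antisymm (incIndex_le_of_equiv σ h) (incIndex_le_of_equiv σ.symm fun i j => by simp [h])

/-- A matrix of matrices is one large matrix; this identification respects products and supports,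
hence stabilizers. It turns inflation of blocks into a change of coefficients. -/
theorem incIndex_comp {ι κ : Type} [Fintype ι] [Fintype κ] [DecidableEq ι] [DecidableEq κ]
    (R : ι → ι → Prop) :
    incIndex ℂ (fun a b : ι × κ => R a.1 b.1) = incIndex (Matrix κ κ ℂ) R := by
  let e := Matrix.compAlgEquiv ι κ ℂ ℂ
  have he : ∀ s a b, e s a b = s a.1 b.1 a.2 b.2 := fun _ _ _ => rfl
  have key : ∀ F s : Matrix ι ι (Matrix κ κ ℂ),
      e s ∈ incStab (fun a b : ι × κ => R a.1 b.1) (e F) ↔ s ∈ incStab R F := by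
    intro F s
    rw [mem_incStab, mem_incStab, ← map_mul, ← map_mul]
    constructor
    · rintro ⟨h1, h2⟩
      refine ⟨fun i j h => ?_, fun i j h => ?_⟩
      · ext a b
        exact h1 (i, a) (j, b) h
      · ext a b
        exact h2 (i, b) (j, a) h
    · rintro ⟨h1, h2⟩
      refine ⟨fun a b h => ?_, fun a b h => ?_⟩
      · rw [he, h1 _ _ h, Matrix.zero_apply]
      · rw [he, he, h2 _ _ h]
  have hfin : ∀ F, finrank ℂ (incStab R F) =
      finrank ℂ (incStab (fun a b : ι × κ => R a.1 b.1) (e F)) := by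
    intro F
    refine finrank_eq_of_map e.toLinearMap (fun s hs => (key F s).mpr hs) (fun s _ hs => ?_)
      (fun t ht => ⟨e.symm t, (key F _).mp ?_, e.apply_symm_apply t⟩)
    · exact (map_eq_zero_iff e e.injective).mp hs
    · rwa [e.apply_symm_apply]
  apply le_antisymm
  · obtain ⟨F, hF⟩ := exists_finrank_incStab_eq (Matrix κ κ ℂ) R
    rw [← hF, hfin]
    exact incIndex_le _ _
  · obtain ⟨F, hF⟩ := exists_finrank_incStab_eq ℂ (fun a b : ι × κ => R a.1 b.1)
    rw [← hF, ← e.apply_symm_apply F, ← hfin]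
    exact incIndex_le _ _

/-- The index is additive on disjoint unions. -/
theorem incIndex_liftRel {α β : Type} [Fintype α] [Fintype β] (R : α → α → Prop)
    (S : β → β → Prop) :
    incIndex D (Sum.LiftRel R S) = incIndex D R + incIndex D S := by
  have key : ∀ F : Matrix (α ⊕ β) (α ⊕ β) D, finrank ℂ (incStab (Sum.LiftRel R S) F) =
      finrank ℂ (incStab R F.toBlocks₁₁) + finrank ℂ (incStab S F.toBlocks₂₂) := by
    intro F
    let f : Matrix (α ⊕ β) (α ⊕ β) D →ₗ[ℂ] Matrix α α D × Matrix β β D :=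
      { toFun := fun s => (s.toBlocks₁₁, s.toBlocks₂₂)
        map_add' := fun _ _ => rfl
        map_smul' := fun _ _ => rfl }
    have hblock : ∀ s : Matrix (α ⊕ β) (α ⊕ β) D, (∀ i j, ¬ Sum.LiftRel R S i j → s i j = 0) →
        s = Matrix.fromBlocks s.toBlocks₁₁ 0 0 s.toBlocks₂₂ := by
      intro s hs
      conv_lhs => rw [← Matrix.fromBlocks_toBlocks s]
      congr 1
      · ext1 i j
        exact hs _ _ (by simp)
      · ext1 i j
        exact hs _ _ (by simp)
    have hm : ∀ a b, Matrix.fromBlocks a 0 0 b ∈ incStab (Sum.LiftRel R S) F ↔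
        a ∈ incStab R F.toBlocks₁₁ ∧ b ∈ incStab S F.toBlocks₂₂ := by
      intro a b
      conv_lhs => rw [← Matrix.fromBlocks_toBlocks F]
      simp only [mem_incStab, Matrix.fromBlocks_multiply]
      constructor
      · rintro ⟨h1, h2⟩
        refine ⟨⟨fun i j h => ?_, fun i j h => ?_⟩, ⟨fun i j h => ?_, fun i j h => ?_⟩⟩
        · simpa using h1 (.inl i) (.inl j) (by simpa using h)
        · simpa using h2 (.inl i) (.inl j) (by simpa using h)
        · simpa using h1 (.inr i) (.inr j) (by simpa using h)
        · simpa using h2 (.inr i) (.inr j) (by simpa using h)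
      · rintro ⟨⟨h1, h2⟩, ⟨h3, h4⟩⟩
        constructor
        · rintro (i | i) (j | j) h
          · exact h1 i j (by simpa using h)
          · rfl
          · rfl
          · exact h3 i j (by simpa using h)
        · rintro (i | i) (j | j) h
          · simpa using h2 i j (by simpa using h)
          · simp at h
          · simp at h
          · simpa using h4 i j (by simpa using h)
    rw [finrank_eq_of_map (T := (incStab R F.toBlocks₁₁).prod (incStab S F.toBlocks₂₂)) f,
      finrank_submodule_prod]
    · intro s hs
      rw [hblock (s : Matrix (α ⊕ β) (α ⊕ β) D) hs.1] at hs
      exact (hm _ _).mp hs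
    · intro s hs h
      rw [hblock (s : Matrix (α ⊕ β) (α ⊕ β) D) hs.1]
      have h1 : s.toBlocks₁₁ = 0 := congrArg Prod.fst h
      have h2 : s.toBlocks₂₂ = 0 := congrArg Prod.snd h
      rw [h1, h2, Matrix.fromBlocks_zero]
    · rintro ⟨a, b⟩ hab
      exact ⟨Matrix.fromBlocks a 0 0 b, (hm a b).mpr hab, rfl⟩
  apply le_antisymm
  · obtain ⟨F, hF⟩ := exists_finrank_incStab_eq D R
    obtain ⟨G, hG⟩ := exists_finrank_incStab_eq D S
    refine (incIndex_le _ (Matrix.fromBlocks F 0 0 G)).trans ?_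
    rw [key, Matrix.toBlocks_fromBlocks₁₁, Matrix.toBlocks_fromBlocks₂₂, hF, hG]
  · obtain ⟨F, hF⟩ := exists_finrank_incStab_eq D (Sum.LiftRel R S)
    rw [← hF, key]
    exact add_le_add (incIndex_le _ _) (incIndex_le _ _)

end Transport

/-! ### The index of the full matrix algebra -/

section Full

/-- Every complex matrix has a centralizer of dimension at least its size. -/
theorem le_finrank_incStab_true {m : ℕ} (F : Matrix (Fin m) (Fin m) ℂ) :
    m ≤ finrank ℂ (incStab (fun _ _ : Fin m => True) F) := by
  -- `G` has distinct eigenvalues and the all-ones vector as a cyclic vector. On the line from `F`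
  -- to `G`, almost every matrix `A` still has this cyclic vector and has a centralizer no larger
  -- than that of `F`; the powers of `A` below `m` are independent elements of it.
  set G : Matrix (Fin m) (Fin m) ℂ := Matrix.diagonal fun i => ((i : ℕ) : ℂ) with hG
  let L : Matrix (Fin m) (Fin m) (Polynomial ℂ) :=
    F.map Polynomial.C + (Polynomial.X : Polynomial ℂ) • (G - F).map Polynomial.C
  let K : Matrix (Fin m) (Fin m) (Polynomial ℂ) := Matrix.of fun i k => ((L ^ (k : ℕ)).mulVec 1) i
  let K' : Matrix (Fin m) (Fin m) ℂ → Matrix (Fin m) (Fin m) ℂ := fun A =>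
    Matrix.of fun i k => ((A ^ (k : ℕ)).mulVec 1) i
  have hL : ∀ t : ℂ, L.map (Polynomial.evalRingHom t) = F + t • (G - F) := by
    intro t
    ext i j
    simp [L]
  have heval : ∀ t : ℂ, K.det.eval t = (K' (F + t • (G - F))).det := by
    intro t
    rw [← Polynomial.coe_evalRingHom, RingHom.map_det]
    congr 1
    ext i k
    have h1 : (L ^ (k : ℕ)).map (Polynomial.evalRingHom t) = (F + t • (G - F)) ^ (k : ℕ) := by
      rw [← hL]
      exact map_pow (Polynomial.evalRingHom t).mapMatrix L k
    have h2 := RingHom.map_mulVec (Polynomial.evalRingHom t) (L ^ (k : ℕ)) 1 i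
    rw [h1] at h2
    refine h2.trans ?_
    have h3 : (⇑(Polynomial.evalRingHom t) ∘ (1 : Fin m → Polynomial ℂ)) = 1 := by
      ext; simp
    rw [h3]
    rfl
  -- For the diagonal matrix the Krylov matrix is a Vandermonde matrix.
  have hG1 : (K' G).det ≠ 0 := by
    have : K' G = Matrix.vandermonde fun i : Fin m => ((i : ℕ) : ℂ) := by
      ext i k
      simp [K', hG, Matrix.diagonal_pow, Matrix.mulVec_diagonal, Matrix.vandermonde_apply]
    rw [this, Matrix.det_vandermonde_ne_zero_iff]
    intro i j hij
    exact Fin.ext (by simpa using hij)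
  have hK0 : K.det ≠ 0 := by
    intro h0
    apply hG1
    have := heval 1
    rw [h0, Polynomial.eval_zero, one_smul, add_sub_cancel] at this
    exact this.symm
  have hne : ∀ᶠ t : ℂ in cofinite, (K' (F + t • (G - F))).det ≠ 0 := by
    refine (K.det.roots.toFinset.finite_toSet).subset ?_
    intro t ht
    have : (K' (F + t • (G - F))).det = 0 := by simpa using ht
    simp only [Finset.mem_coe, Multiset.mem_toFinset, Polynomial.mem_roots hK0,
      Polynomial.IsRoot.def]
    rw [heval, this]
  obtain ⟨t, ht1, ht2⟩ := ((eventually_finrank_incStab_add_smul_le (fun _ _ : Fin m => True)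
    F (G - F)).and hne).exists
  refine le_trans ?_ ht1
  set A := F + t • (G - F)
  let f : (Fin m → ℂ) →ₗ[ℂ] Matrix (Fin m) (Fin m) ℂ :=
    { toFun := fun a => ∑ k, a k • A ^ (k : ℕ)
      map_add' := fun a b => by simp [add_smul, Finset.sum_add_distrib]
      map_smul' := fun r a => by simp [mul_smul, Finset.smul_sum] }
  have hf : ∀ a, f a = ∑ k, a k • A ^ (k : ℕ) := fun _ => rfl
  have h := finrank_le_of_injOn (S := (⊤ : Submodule ℂ (Fin m → ℂ)))
    (T := incStab (fun _ _ : Fin m => True) A) f ?_ ?_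
  · simpa using h
  · intro a _
    refine ⟨fun i j h => absurd trivial h, fun i j _ => ?_⟩
    have : A * f a = f a * A := by
      rw [hf, Finset.mul_sum, Finset.sum_mul]
      refine Finset.sum_congr rfl fun k _ => ?_
      rw [Matrix.mul_smul, Matrix.smul_mul, ← pow_succ, ← pow_succ']
    rw [this]
  · intro a _ ha
    have h1 : (K' A).mulVec a = 0 := by
      have : (K' A).mulVec a = (f a).mulVec 1 := by
        ext i
        rw [hf, Matrix.sum_mulVec, Finset.sum_apply]
        simp only [Matrix.smul_mulVec, Pi.smul_apply, smul_eq_mul]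
        rw [Matrix.mulVec, dotProduct]
        exact Finset.sum_congr rfl fun k _ => mul_comm _ _
      rw [this, ha, Matrix.zero_mulVec]
    exact Matrix.eq_zero_of_mulVec_eq_zero ht2 h1

/-- The index of the general linear Lie algebra. -/
theorem incIndex_true {ι : Type} [Fintype ι] :
    incIndex ℂ (fun _ _ : ι => True) = Fintype.card ι := by
  classical
  rw [incIndex_congr (Fintype.equivFin ι) (R' := fun _ _ => True) fun _ _ => Iff.rfl]
  set m := Fintype.card ι
  apply le_antisymm
  -- A diagonal matrix with distinct entries commutes only with diagonal matrices.
  · set G : Matrix (Fin m) (Fin m) ℂ := Matrix.diagonal fun i => ((i : ℕ) : ℂ) with hG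
    refine (incIndex_le _ G).trans ?_
    have h := finrank_le_of_injOn (S := incStab (fun _ _ : Fin m => True) G)
      (T := (⊤ : Submodule ℂ (Fin m → ℂ))) (Matrix.diagLinearMap (Fin m) ℂ ℂ)
      (fun _ _ => trivial) ?_
    · simpa using h
    · intro s hs h
      ext i j
      by_cases hij : i = j
      · subst hij
        exact congrFun h i
      · have := hs.2 j i trivial
        rw [hG, Matrix.diagonal_mul, Matrix.mul_diagonal, mul_comm, ← sub_eq_zero, ← mul_sub] at this
        refine (mul_eq_zero.mp this).resolve_right (sub_ne_zero.mpr fun h' => hij ?_)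
        exact Fin.ext (by exact_mod_cast h')
  · obtain ⟨F, hF⟩ := exists_finrank_incStab_eq ℂ (fun _ _ : Fin m => True)
    rw [← hF]
    exact le_finrank_incStab_true F

end Full

/-! ### Reductions of the leading blocks -/

section ListRel

/-- The number of the block that contains position `i`, for consecutive blocks of sizes `l`. -/
def blockNumber : List ℕ → ℕ → ℕ
  | [], _ => 0
  | a :: l, i => if i < a then 0 else blockNumber l (i - a) + 1

theorem blockNumber_cons_of_lt {a i : ℕ} (l : List ℕ) (h : i < a) : blockNumber (a :: l) i = 0 :=
  if_pos h

theorem blockNumber_cons_add (a : ℕ) (l : List ℕ) (i : ℕ) :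
    blockNumber (a :: l) (a + i) = blockNumber l i + 1 := by
  rw [blockNumber, if_neg (by omega), Nat.add_sub_cancel_left]

theorem blockNumber_cons_eq_zero_iff {a i : ℕ} (l : List ℕ) :
    blockNumber (a :: l) i = 0 ↔ i < a := by
  rw [blockNumber]
  split_ifs with h
  · simp [h]
  · simp [h]

theorem blockNumber_one_cons_succ (l : List ℕ) (i : ℕ) :
    blockNumber (1 :: l) (i + 1) = blockNumber l i + 1 := by
  rw [add_comm i 1, blockNumber_cons_add]

theorem blockNumber_succ_succ (a : ℕ) (l : List ℕ) (i : ℕ) :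
    blockNumber ((a + 2) :: l) (i + 1) = blockNumber ((a + 1) :: l) i := by
  rw [blockNumber, blockNumber]
  by_cases h : i < a + 1
  · rw [if_pos (by omega), if_pos h]
  · rw [if_neg (by omega), if_neg h]
    congr 2
    omega

theorem blockNumber_mono (l : List ℕ) : Monotone (blockNumber l) := by
  induction l with
  | nil => exact fun _ _ _ => le_rfl
  | cons a l ih =>
    intro i j hij
    rw [blockNumber, blockNumber]
    split_ifs with h1 h2
    · exact le_rfl
    · exact Nat.zero_le _
    · omega
    · exact Nat.succ_le_succ (ih (by omega))

theorem blockNumber_eq_of_between {l : List ℕ} {i k j : ℕ} (hik : i ≤ k) (hkj : k ≤ j)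
    (h : blockNumber l i = blockNumber l j) :
    blockNumber l i = blockNumber l k ∧ blockNumber l k = blockNumber l j := by
  have h1 := blockNumber_mono l hik
  have h2 := blockNumber_mono l hkj
  omega

/-- The relation on positions that defines the seaweed algebra of a pair of lists of block
sizes. -/
def listRel (l m : List ℕ) (i j : ℕ) : Prop :=
  (i < j → blockNumber l i = blockNumber l j) ∧ (j < i → blockNumber m i = blockNumber m j)

theorem listRel_refl (l m : List ℕ) (i : ℕ) : listRel l m i i :=
  ⟨fun h => absurd h (lt_irrefl i), fun h => absurd h (lt_irrefl i)⟩

theorem listRel_swap {l m : List ℕ} {i j : ℕ} : listRel l m j i ↔ listRel m l i j :=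
  ⟨fun h => ⟨fun h' => (h.2 h').symm, fun h' => (h.1 h').symm⟩,
    fun h => ⟨fun h' => (h.2 h').symm, fun h' => (h.1 h').symm⟩⟩

theorem listRel_trans {l m : List ℕ} {i k j : ℕ} (h1 : listRel l m i k) (h2 : listRel l m k j) :
    listRel l m i j := by
  constructor
  · intro hij
    rcases lt_trichotomy i k with hik | hik | hik
    · rcases lt_trichotomy k j with hkj | hkj | hkj
      · exact (h1.1 hik).trans (h2.1 hkj)
      · exact hkj ▸ h1.1 hik
      · exact (blockNumber_eq_of_between hij.le hkj.le (h1.1 hik)).1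
    · exact hik ▸ h2.1 (hik ▸ hij)
    · exact (blockNumber_eq_of_between hik.le hij.le (h2.1 (hik.trans hij))).2
  · intro hji
    rcases lt_trichotomy k i with hki | hki | hki
    · rcases lt_trichotomy j k with hjk | hjk | hjk
      · exact (h1.2 hki).trans (h2.2 hjk)
      · exact hjk ▸ h1.2 hki
      · exact (blockNumber_eq_of_between hjk.le hji.le (h1.2 hki).symm).2.symm
    · exact hki ▸ h2.2 (hki ▸ hji)
    · exact (blockNumber_eq_of_between hji.le hki.le (h2.2 (hji.trans hki)).symm).1.symm

theorem listRel_succ_zero {a : ℕ} {l m : List ℕ} {j : ℕ} :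
    listRel l ((a + 1) :: m) (j + 1) 0 ↔ j < a := by
  have h0 := blockNumber_cons_of_lt m (Nat.succ_pos a)
  refine ⟨fun h => ?_, fun h => ⟨fun h' => absurd h' (by omega), fun _ => ?_⟩⟩
  · have := h.2 (Nat.succ_pos j)
    rw [h0, blockNumber_cons_eq_zero_iff] at this
    omega
  · rw [h0, blockNumber_cons_eq_zero_iff]
    omega

theorem listRel_zero_succ {a : ℕ} {l m : List ℕ} {j : ℕ} :
    listRel ((a + 1) :: l) m 0 (j + 1) ↔ j < a :=
  listRel_swap.trans listRel_succ_zero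

/-- The index of the seaweed algebra with blocks of sizes `c * l` and `c * m` on `c * N` nodes. -/
noncomputable def listIndex (c N : ℕ) (l m : List ℕ) : ℕ :=
  incIndex (Matrix (Fin c) (Fin c) ℂ) (fun i j : Fin N => listRel l m i j)

theorem listIndex_swap (c N : ℕ) (l m : List ℕ) : listIndex c N l m = listIndex c N m l := by
  rw [listIndex, ← incIndex_swap]
  exact incIndex_congr (Equiv.refl _) fun i j => listRel_swap

/-- The upper block 1 makes node `0` reach nothing else, and only node `1` reaches it. There is no
further predecessor, so no other arrow is lost. -/
theorem listIndex_one_two (c N : ℕ) (l m : List ℕ) :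
    listIndex c (N + 2) (1 :: l) (2 :: m) = listIndex c (N + 1) l (1 :: m) := by
  rw [listIndex, incIndex_removeLeaf (q := 0) (R := fun i j : Fin (N + 2) => listRel (1 :: l) (2 :: m) i j)
    (fun i => listRel_refl _ _ _)
    (fun i j k => listRel_trans)]
  · refine incIndex_congr (Equiv.refl _) fun i j => ?_
    simp only [removeLeaf, Fin.val_succ, Fin.val_zero, Equiv.refl_apply, listRel_succ_zero]
    have : ¬ (i = 0 ∧ j ≠ 0 ∧ (j : ℕ) < 1) := fun h => h.2.1 (Fin.ext (by simpa using h.2.2))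
    rw [and_iff_left this]
    simp only [listRel, blockNumber_one_cons_succ, blockNumber_succ_succ 0, add_lt_add_iff_right,
      zero_add, Nat.add_right_cancel_iff]
  · intro j
    simp [listRel_zero_succ (a := 0)]
  · simp [listRel_succ_zero (a := 1)]
  · intro i h
    have h' : (i : ℕ) < 1 := by simpa [listRel_succ_zero (a := 1)] using h
    have : i = 0 := Fin.ext (by simpa using h')
    rw [this]
    exact listRel_refl _ _ _

/-- Node `0` reaches nothing else and its predecessors are the nodes `1` and `2`. With `q` the node
`2`, the arrow from `2` to `1` is lost, which splits what is left of the lower block 3 into two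
blocks 1. -/
theorem listIndex_one_three (c N : ℕ) (l m : List ℕ) :
    listIndex c (N + 3) (1 :: l) (3 :: m) = listIndex c (N + 2) l (1 :: 1 :: m) := by
  rw [listIndex, incIndex_removeLeaf (q := 1) (R := fun i j : Fin (N + 3) => listRel (1 :: l) (3 :: m) i j)
    (fun i => listRel_refl _ _ _)
    (fun i j k => listRel_trans)]
  · refine incIndex_congr (Equiv.refl _) fun i j => ?_
    simp only [removeLeaf, Fin.val_succ, Fin.val_zero, Equiv.refl_apply, listRel_succ_zero]
    simp only [listRel, blockNumber_one_cons_succ, blockNumber_succ_succ 1, add_lt_add_iff_right,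
      Nat.add_right_cancel_iff]
    have h1 : (i = 1) ↔ (i : ℕ) = 1 := by rw [Fin.ext_iff]; rfl
    have h2 : (j = 1) ↔ (j : ℕ) = 1 := by rw [Fin.ext_iff]; rfl
    rw [and_assoc, Ne, h1, h2]
    refine and_congr_right fun _ => ?_
    generalize (i : ℕ) = a
    generalize (j : ℕ) = b
    have e2 : ∀ n, blockNumber (1 :: 1 :: m) (n + 2) = blockNumber m n + 2 := fun n => by
      rw [blockNumber_one_cons_succ, blockNumber_one_cons_succ]
    have e3 : ∀ n, blockNumber (2 :: m) (n + 2) = blockNumber m n + 1 := fun n => by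
      rw [add_comm, blockNumber_cons_add]
    have f0 : blockNumber (1 :: 1 :: m) 0 = 0 := rfl
    have f1 : blockNumber (1 :: 1 :: m) 1 = 1 := rfl
    have g0 : blockNumber (2 :: m) 0 = 0 := rfl
    have g1 : blockNumber (2 :: m) 1 = 0 := rfl
    rcases a with _ | _ | a <;> rcases b with _ | _ | b <;> simp [e2, e3, f0, f1, g0, g1]
  · intro j
    simp [listRel_zero_succ (a := 0)]
  · simp only [Fin.val_succ, Fin.val_one, Fin.val_zero, listRel_succ_zero (a := 2)]
    omega
  · intro i h
    have h' : (i : ℕ) < 2 := by simpa [listRel_succ_zero (a := 2)] using h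
    refine ⟨fun h'' => ?_, fun _ => ?_⟩
    · simp only [Fin.val_succ, Fin.val_one] at h''
      omega
    · rw [blockNumber_cons_of_lt, blockNumber_cons_of_lt]
      · simp only [Fin.val_succ]; omega
      · simp only [Fin.val_succ, Fin.val_one]; omega

/-- Nodes `0` and `1` are equivalent, and node `2`, in the role of `q`, reaches both and is reached
by no other node. Removing `0` therefore just shortens both leading blocks. -/
theorem listIndex_two_three (c N : ℕ) (l m : List ℕ) :
    listIndex c (N + 3) (2 :: l) (3 :: m) = listIndex c (N + 2) (1 :: l) (2 :: m) := by
  rw [listIndex, incIndex_removeTwin (q := 1) (R := fun i j : Fin (N + 3) => listRel (2 :: l) (3 :: m) i j)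
    (fun i => listRel_refl _ _ _)
    (fun i j k => listRel_trans)]
  · refine incIndex_congr (Equiv.refl _) fun i j => ?_
    simp only [listRel, Fin.val_succ, Equiv.refl_apply, blockNumber_succ_succ 0,
      blockNumber_succ_succ 1, add_lt_add_iff_right, zero_add]
  · intro w
    simp only [Fin.val_succ, Fin.val_zero, listRel_succ_zero (a := 2), listRel_zero_succ (a := 1)]
    omega
  · simp only [Fin.val_succ, Fin.val_one, Fin.val_zero, listRel_succ_zero (a := 2)]
    omega
  · simp only [Fin.val_succ, Fin.val_one, Fin.val_zero, listRel_zero_succ (a := 1)]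
    omega
  · intro i
    simp only [Fin.val_succ, Fin.val_zero, listRel_succ_zero (a := 2), listRel_zero_succ (a := 1),
      Fin.ext_iff, Fin.val_one]
    omega
  · intro i h
    simp only [Fin.val_succ, Fin.val_one] at h
    rw [Fin.ext_iff, Fin.val_one]
    rcases lt_trichotomy (i : ℕ) 1 with hi | hi | hi
    · have := h.1 (by omega)
      rw [blockNumber_cons_of_lt _ (by omega), blockNumber, if_neg (by omega)] at this
      omega
    · exact hi
    · have := h.2 (by omega)
      rw [blockNumber_cons_of_lt (i := 1 + 1) _ (by omega), blockNumber, if_neg (by omega)] at this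
      omega

/-- The relation is a disjoint union whose first component is full on `k` nodes; over `c × c`
matrices this is a full matrix algebra of size `k * c`. -/
theorem listIndex_cons_cons (c N k : ℕ) (l m : List ℕ) :
    listIndex c (k + N) (k :: l) (k :: m) = k * c + listIndex c N l m := by
  have h1 : incIndex (Matrix (Fin c) (Fin c) ℂ) (fun _ _ : Fin k => True) = k * c := by
    rw [← incIndex_comp, incIndex_true]
    simp
  rw [← h1, listIndex, listIndex, ← incIndex_liftRel]
  symm
  refine incIndex_congr finSumFinEquiv ?_
  rintro (i | i) (j | j)
  · simp [listRel, blockNumber_cons_of_lt]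
  · have : (i : ℕ) < k + j := by omega
    simp [listRel, blockNumber_cons_of_lt, blockNumber_cons_add, this]
  · have : (j : ℕ) < k + i := by omega
    simp [listRel, blockNumber_cons_of_lt, blockNumber_cons_add, this]
  · simp [listRel, blockNumber_cons_add]

end ListRel

/-! ### From the seaweed algebra to the combinatorial index -/

section Bridge

attribute [local instance 100] LieRing.ofAssociativeRing

theorem trace_mul_eq_sum {n : ℕ} (A B : Matrix (Fin n) (Fin n) ℂ) :
    (A * B).trace = ∑ i, ∑ j, A j i * B i j := by
  rw [Matrix.trace, Finset.sum_comm]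
  simp only [Matrix.diag_apply, Matrix.mul_apply]

/-- Cyclicity of the trace turns `f ⁅x, y⁆` into the trace of `(F x - x F) y`. Testing against the
matrix units of the algebra isolates the entries of `F x - x F`. -/
theorem Meander.finrank_coadjointStabilizer {n : ℕ} (m : Meander n) (f : Dual ℂ m.seaweed)
    (F : Matrix (Fin n) (Fin n) ℂ) (hf : ∀ s : m.seaweed, f s = (F * s.1).trace) :
    finrank ℂ (coadjointStabilizer f) = finrank ℂ (incStab m.Allowed F) := by
  classical
  have hbr : ∀ x y : m.seaweed, f ⁅x, y⁆ = ((F * x.1 - x.1 * F) * y.1).trace := by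
    intro x y
    have h1 : (⁅x, y⁆ : m.seaweed).1 = x.1 * y.1 - y.1 * x.1 := rfl
    rw [hf, h1, mul_sub, sub_mul, Matrix.trace_sub, Matrix.trace_sub, mul_assoc]
    congr 1
    rw [mul_assoc x.1, Matrix.trace_mul_comm x.1, mul_assoc]
  have hmem : ∀ x : m.seaweed, x ∈ coadjointStabilizer f ↔ x.1 ∈ incStab m.Allowed F := by
    intro x
    rw [mem_incStab]
    constructor
    · intro hx
      refine ⟨fun i j h => by_contra fun h' => h (x.2 i j h'), fun i j h => ?_⟩
      have hy : Matrix.single i j (1 : ℂ) ∈ m.seaweed := by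
        intro a b hab
        by_cases h' : i = a ∧ j = b
        · rwa [← h'.1, ← h'.2]
        · exact absurd (Matrix.single_apply_of_ne _ _ _ _ _ h') hab
      have := hx ⟨_, hy⟩
      rw [hbr, Matrix.trace_mul_single] at this
      simpa [sub_eq_zero] using this
    · rintro ⟨-, h2⟩ y
      rw [hbr, trace_mul_eq_sum]
      refine Finset.sum_eq_zero fun i _ => Finset.sum_eq_zero fun j _ => ?_
      by_cases h : m.Allowed i j
      · rw [Matrix.sub_apply, h2 i j h, sub_self, zero_mul]
      · have : y.1 i j = 0 := by_contra fun h' => h (y.2 i j h')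
        rw [this, mul_zero]
  refine finrank_eq_of_map m.seaweed.toSubmodule.subtype (fun x hx => (hmem x).mp hx)
    (fun x _ hx => Subtype.ext hx) (fun s hs => ?_)
  have hs' : s ∈ m.seaweed := fun i j h => by_contra fun h' => h (hs.1 i j h')
  exact ⟨⟨s, hs'⟩, (hmem _).mpr hs, rfl⟩

theorem Meander.ind_eq_incIndex {n : ℕ} (m : Meander n) : m.ind = incIndex ℂ m.Allowed := by
  classical
  apply le_antisymm
  · obtain ⟨F, hF⟩ := exists_finrank_incStab_eq ℂ m.Allowed
    let f : Dual ℂ m.seaweed :=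
      (Matrix.traceLinearMap (Fin n) ℂ ℂ ∘ₗ LinearMap.mulLeft ℂ F) ∘ₗ m.seaweed.toSubmodule.subtype
    rw [← hF, ← m.finrank_coadjointStabilizer f F fun _ => rfl]
    exact ciInf_le (OrderBot.bddBelow _) f
  · obtain ⟨f, hf⟩ : ∃ f : Dual ℂ m.seaweed, finrank ℂ (coadjointStabilizer f) = m.ind :=
      Nat.sInf_mem (Set.range_nonempty _)
    -- Every form on the seaweed algebra extends to all matrices and so is a trace form.
    obtain ⟨g, hg⟩ := LinearMap.exists_extend (p := m.seaweed.toSubmodule) f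
    rw [← hf, m.finrank_coadjointStabilizer f (Matrix.of fun j i => g (Matrix.single i j 1))]
    · exact incIndex_le _ _
    · intro s
      have h1 : f s = g s.1 := (LinearMap.congr_fun hg s).symm
      rw [h1, trace_mul_eq_sum]
      conv_lhs => rw [Matrix.matrix_eq_sum_single s.1]
      simp only [map_sum]
      refine Finset.sum_congr rfl fun i _ => Finset.sum_congr rfl fun j _ => ?_
      have : Matrix.single i j (s.1 i j) = s.1 i j • Matrix.single i j (1 : ℂ) := by
        rw [Matrix.smul_single, smul_eq_mul, mul_one]
      rw [this, map_smul, smul_eq_mul, mul_comm]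
      rfl

theorem blockNumber_eq_of_take {l : List ℕ} {k i : ℕ} (h1 : (l.take k).sum ≤ i)
    (h2 : i < (l.take (k + 1)).sum) : blockNumber l i = k := by
  induction l generalizing k i with
  | nil => simp at h2
  | cons a l ih =>
    cases k with
    | zero => exact blockNumber_cons_of_lt l (by simpa using h2)
    | succ k =>
      simp only [List.take_succ_cons, List.sum_cons] at h1 h2
      rw [blockNumber, if_neg (by omega), ih (k := k) (by omega) (by omega)]

theorem Composition.index_eq_blockNumber {n : ℕ} (c : Composition n) (i : Fin n) :
    (c.index i : ℕ) = blockNumber c.blocks i :=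
  (blockNumber_eq_of_take (c.sizeUpTo_index_le i) (c.lt_sizeUpTo_index_succ i)).symm

theorem blockNumber_map_mul {c : ℕ} (hc : 0 < c) (l : List ℕ) (i : ℕ) :
    blockNumber (l.map (c * ·)) i = blockNumber l (i / c) := by
  induction l generalizing i with
  | nil => rfl
  | cons a l ih =>
    have h : i < c * a ↔ i / c < a := by rw [Nat.div_lt_iff_lt_mul hc, mul_comm]
    rw [List.map_cons, blockNumber, blockNumber, ih, Nat.sub_mul_div]
    simp only [h]

theorem Meander.ind_eq_listIndex {c N : ℕ} (hc : 0 < c) (M : Meander (N * c)) {l m : List ℕ}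
    (hl : M.top.blocks = l.map (c * ·)) (hm : M.bot.blocks = m.map (c * ·)) :
    M.ind = listIndex c N l m := by
  rw [M.ind_eq_incIndex, listIndex, ← incIndex_comp]
  refine incIndex_congr finProdFinEquiv.symm fun i j => ?_
  have e : ∀ i : Fin (N * c), ((finProdFinEquiv.symm i).1 : ℕ) = (i : ℕ) / c := fun _ => rfl
  rw [e, e, Meander.Allowed, Fin.ext_iff, Fin.ext_iff, Composition.index_eq_blockNumber,
    Composition.index_eq_blockNumber, Composition.index_eq_blockNumber,
    Composition.index_eq_blockNumber, hl, hm, blockNumber_map_mul hc, blockNumber_map_mul hc,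
    blockNumber_map_mul hc, blockNumber_map_mul hc]
  -- Nodes with the same quotient satisfy the conclusion trivially, so comparing positions and
  -- comparing quotients give the same condition.
  have key : ∀ (a b : ℕ) (x : ℕ → ℕ), ((a < b → x (a / c) = x (b / c)) ↔
      (a / c < b / c → x (a / c) = x (b / c))) := by
    intro a b x
    constructor
    · exact fun h h' => h (lt_of_not_ge fun h'' => absurd (Nat.div_le_div_right h'') (not_le.mpr h'))
    · intro h h'
      rcases (Nat.div_le_div_right (c := c) h'.le).lt_or_eq with h'' | h''
      · exact h h''
      · rw [h'']
  refine and_congr (key i j _) ?_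
  have := key j i (blockNumber m)
  constructor
  · exact fun h h' => ((this.mp fun h'' => (h h'').symm) h').symm
  · exact fun h h' => ((this.mpr fun h'' => (h h'').symm) h').symm

end Bridge

/-! ### Transitions of the index between the three states -/

section ListIndexRecursion

theorem listIndex_two_two (c n : ℕ) (l m : List ℕ) :
    listIndex c (n + 2) (2 :: l) (2 :: m) = listIndex c n l m + c * 2 := by
  rw [add_comm n 2, listIndex_cons_cons, add_comm, mul_comm]

theorem listIndex_three_three (c n : ℕ) (l m : List ℕ) :
    listIndex c (n + 3) (3 :: l) (3 :: m) = listIndex c n l m + c * 3 := by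
  rw [add_comm n 3, listIndex_cons_cons, add_comm, mul_comm]

theorem listIndex_two_three' (c n : ℕ) (l m : List ℕ) :
    listIndex c (n + 3) (2 :: l) (3 :: m) = listIndex c (n + 1) l (1 :: m) := by
  rw [listIndex_two_three, listIndex_one_two]

theorem listIndex_three_two (c n : ℕ) (l m : List ℕ) :
    listIndex c (n + 3) (3 :: l) (2 :: m) = listIndex c (n + 1) m (1 :: l) := by
  rw [listIndex_swap, listIndex_two_three']

theorem listIndex_two_one (c n : ℕ) (l m : List ℕ) :
    listIndex c (n + 2) (2 :: l) (1 :: m) = listIndex c (n + 1) m (1 :: l) := by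
  rw [listIndex_swap, listIndex_one_two]

theorem listIndex_three_one (c n : ℕ) (l m : List ℕ) :
    listIndex c (n + 3) (3 :: l) (1 :: m) = listIndex c (n + 2) m (1 :: 1 :: l) := by
  rw [listIndex_swap, listIndex_one_three]

theorem listIndex_two_one_one (c n : ℕ) (l m : List ℕ) :
    listIndex c (n + 2) (2 :: l) (1 :: 1 :: m) = listIndex c n m l + c := by
  rw [listIndex_two_one, add_comm n 1, listIndex_cons_cons, one_mul, add_comm]

theorem listIndex_three_one_one (c n : ℕ) (l m : List ℕ) :
    listIndex c (n + 3) (3 :: l) (1 :: 1 :: m) = listIndex c (n + 1) m (1 :: l) + c := by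
  rw [listIndex_three_one, add_comm n 2, add_comm 2 n, show n + 2 = 1 + (n + 1) by ring,
    listIndex_cons_cons, one_mul, add_comm]

theorem listIndex_zero (c : ℕ) (l m : List ℕ) : listIndex c 0 l m = 0 := by
  refine Nat.le_zero.mp ((incIndex_le _ 0).trans ?_)
  rw [Module.finrank_zero_of_subsingleton]

/-- Index of a pair of lists with equal sums. -/
noncomputable def pairIndex₀ (c : ℕ) (p : List ℕ × List ℕ) : ℕ := listIndex c p.1.sum p.1 p.2

/-- Index of a pair of lists where the second one gets an additional first part `1`. -/
noncomputable def pairIndex₁ (c : ℕ) (p : List ℕ × List ℕ) : ℕ :=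
  listIndex c p.1.sum p.1 (1 :: p.2)

/-- Index of a pair of lists where the second one gets two additional first parts `1`. -/
noncomputable def pairIndex₂ (c : ℕ) (p : List ℕ × List ℕ) : ℕ :=
  listIndex c p.1.sum p.1 (1 :: 1 :: p.2)

variable (c : ℕ) {l m : List ℕ}

theorem pairIndex₀_nil : pairIndex₀ c ([], m) = 0 := listIndex_zero _ _ _

theorem pairIndex₀_two_two : pairIndex₀ c (2 :: l, 2 :: m) = pairIndex₀ c (l, m) + c * 2 := by
  simp only [pairIndex₀, List.sum_cons, add_comm 2, listIndex_two_two]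

theorem pairIndex₀_three_three : pairIndex₀ c (3 :: l, 3 :: m) = pairIndex₀ c (l, m) + c * 3 := by
  simp only [pairIndex₀, List.sum_cons, add_comm 3, listIndex_three_three]

theorem pairIndex₀_two_three (h : l.sum = m.sum + 1) :
    pairIndex₀ c (2 :: l, 3 :: m) = pairIndex₁ c (l, m) := by
  simp only [pairIndex₀, pairIndex₁, List.sum_cons, h]
  rw [← listIndex_two_three']
  congr 1
  omega

theorem pairIndex₀_three_two (h : m.sum = l.sum + 1) :
    pairIndex₀ c (3 :: l, 2 :: m) = pairIndex₁ c (m, l) := by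
  simp only [pairIndex₀, pairIndex₁, List.sum_cons, h]
  rw [← listIndex_three_two]
  congr 1
  omega

theorem pairIndex₁_two (h : m.sum = l.sum + 1) :
    pairIndex₁ c (2 :: l, m) = pairIndex₁ c (m, l) := by
  simp only [pairIndex₁, List.sum_cons, h]
  rw [← listIndex_two_one]
  congr 1
  omega

theorem pairIndex₁_three (h : m.sum = l.sum + 2) :
    pairIndex₁ c (3 :: l, m) = pairIndex₂ c (m, l) := by
  simp only [pairIndex₁, pairIndex₂, List.sum_cons, h]
  rw [← listIndex_three_one]
  congr 1
  omega

theorem pairIndex₂_two (h : m.sum = l.sum) :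
    pairIndex₂ c (2 :: l, m) = pairIndex₀ c (m, l) + c := by
  simp only [pairIndex₂, pairIndex₀, List.sum_cons, h]
  rw [← listIndex_two_one_one]
  congr 1
  omega

theorem pairIndex₂_three (h : m.sum = l.sum + 1) :
    pairIndex₂ c (3 :: l, m) = pairIndex₁ c (m, l) + c := by
  simp only [pairIndex₂, pairIndex₁, List.sum_cons, h]
  rw [← listIndex_three_one_one]
  congr 1
  omega

end ListIndexRecursion

/-! ### Walks of pairs of lists with parts 2 and 3 -/

section TwoThree

/-- All entries of the list are `2` or `3`. -/
def IsTwoThree (l : List ℕ) : Prop := ∀ p ∈ l, p = 2 ∨ p = 3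

theorem isTwoThree_cons {a : ℕ} {l : List ℕ} :
    IsTwoThree (a :: l) ↔ (a = 2 ∨ a = 3) ∧ IsTwoThree l :=
  List.forall_mem_cons

theorem isTwoThree_nil : IsTwoThree [] := fun _ h => absurd h List.not_mem_nil

/-- A nonempty list with entries `2` and `3` starts with `2` or with `3`. -/
theorem IsTwoThree.exists_cons {l : List ℕ} (hl : IsTwoThree l) (h : 0 < l.sum) :
    ∃ l', IsTwoThree l' ∧ (l = 2 :: l' ∨ l = 3 :: l') := by
  cases l with
  | nil => simp at h
  | cons a l =>
    obtain ⟨ha, hl'⟩ := isTwoThree_cons.mp hl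
    rcases ha with rfl | rfl
    · exact ⟨l, hl', .inl rfl⟩
    · exact ⟨l, hl', .inr rfl⟩

theorem IsTwoThree.eq_nil {l : List ℕ} (hl : IsTwoThree l) (h : l.sum = 0) : l = [] := by
  cases l with
  | nil => rfl
  | cons a l =>
    rw [List.sum_cons] at h
    rcases (isTwoThree_cons.mp hl).1 with rfl | rfl <;> omega

/-- The pairs of lists with entries `2` and `3` and with equal sums. -/
def balancedPairs : Set (List ℕ × List ℕ) :=
  {p | IsTwoThree p.1 ∧ IsTwoThree p.2 ∧ p.1.sum = p.2.sum}

/-- The pairs of lists that are read off by a walk in which the list with the smaller sum is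
always extended by its next entry. The excess of the first sum is `1` for `false` and `2` for
`true`; the walk ends with a pair in `B`. -/
inductive Chain (B : Set (List ℕ × List ℕ)) : Bool → List ℕ → List ℕ → Prop
  | one_two {l m : List ℕ} : Chain B false m l → Chain B false (2 :: l) m
  | one_three {l m : List ℕ} : Chain B true m l → Chain B false (3 :: l) m
  | two_two {l m : List ℕ} : (m, l) ∈ B → Chain B true (2 :: l) m
  | two_three {l m : List ℕ} : Chain B false m l → Chain B true (3 :: l) m

/-- A property whose instances unfold like those of `Chain` implies it. -/
theorem Chain.of_unfold {B : Set (List ℕ × List ℕ)} {C : Bool → List ℕ → List ℕ → Prop}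
    (h1 : ∀ l m, C false l m →
      (∃ l', l = 2 :: l' ∧ C false m l') ∨ ∃ l', l = 3 :: l' ∧ C true m l')
    (h2 : ∀ l m, C true l m → (∃ l', l = 2 :: l' ∧ (m, l') ∈ B) ∨ ∃ l', l = 3 :: l' ∧ C false m l')
    {b : Bool} {l m : List ℕ} (h : C b l m) : Chain B b l m := by
  induction hk : l.length + m.length using Nat.strong_induction_on generalizing b l m with
  | _ k ih =>
    subst hk
    cases b with
    | false =>
      rcases h1 l m h with ⟨l', rfl, h'⟩ | ⟨l', rfl, h'⟩
      · exact .one_two (ih _ (by simp only [List.length_cons]; omega) h' rfl)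
      · exact .one_three (ih _ (by simp only [List.length_cons]; omega) h' rfl)
    | true =>
      rcases h2 l m h with ⟨l', rfl, h'⟩ | ⟨l', rfl, h'⟩
      · exact .two_two h'
      · exact .two_three (ih _ (by simp only [List.length_cons]; omega) h' rfl)

theorem Chain.isTwoThree_and_sum {B : Set (List ℕ × List ℕ)} (hB : B ⊆ balancedPairs) {b : Bool}
    {l m : List ℕ} (h : Chain B b l m) :
    IsTwoThree l ∧ IsTwoThree m ∧ l.sum = m.sum + (if b then 2 else 1) := by
  induction h with
  | one_two _ ih =>
    obtain ⟨h1, h2, h3⟩ := ih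
    refine ⟨isTwoThree_cons.mpr ⟨.inl rfl, h2⟩, h1, ?_⟩
    rw [List.sum_cons, h3]
    simp
    omega
  | one_three _ ih =>
    obtain ⟨h1, h2, h3⟩ := ih
    refine ⟨isTwoThree_cons.mpr ⟨.inr rfl, h2⟩, h1, ?_⟩
    rw [List.sum_cons, h3]
    simp
    omega
  | two_two h =>
    obtain ⟨h1, h2, h3⟩ := hB h
    refine ⟨isTwoThree_cons.mpr ⟨.inl rfl, h2⟩, h1, ?_⟩
    dsimp only at h3
    rw [List.sum_cons, h3]
    simp
    omega
  | two_three _ ih =>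
    obtain ⟨h1, h2, h3⟩ := ih
    refine ⟨isTwoThree_cons.mpr ⟨.inr rfl, h2⟩, h1, ?_⟩
    rw [List.sum_cons, h3]
    simp
    omega

/-- A positive excess makes the first list nonempty, and its head selects the next rule; the sum
condition passes to the swapped pair. -/
theorem Chain.of_sum {b : Bool} {l m : List ℕ} (hl : IsTwoThree l) (hm : IsTwoThree m)
    (h : l.sum = m.sum + (if b then 2 else 1)) : Chain balancedPairs b l m := by
  refine Chain.of_unfold (C := fun b l m => IsTwoThree l ∧ IsTwoThree m ∧
    l.sum = m.sum + (if b then 2 else 1)) ?_ ?_ ⟨hl, hm, h⟩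
  · rintro l m ⟨hl, hm, h⟩
    simp only [Bool.false_eq_true, if_false] at h
    obtain ⟨l', hl', rfl | rfl⟩ := hl.exists_cons (by omega)
    · refine .inl ⟨l', rfl, hm, hl', ?_⟩
      rw [List.sum_cons] at h
      simp
      omega
    · refine .inr ⟨l', rfl, hm, hl', ?_⟩
      rw [List.sum_cons] at h
      simp
      omega
  · rintro l m ⟨hl, hm, h⟩
    simp only [if_true] at h
    obtain ⟨l', hl', rfl | rfl⟩ := hl.exists_cons (by omega)
    · refine .inl ⟨l', rfl, hm, hl', ?_⟩
      rw [List.sum_cons] at h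
      dsimp only
      omega
    · refine .inr ⟨l', rfl, hm, hl', ?_⟩
      rw [List.sum_cons] at h
      simp
      omega

/-- The pairs whose walk starts and ends with equal sums and first returns to equal sums at a
pair in `B`. -/
inductive FirstReturn (B : Set (List ℕ × List ℕ)) : List ℕ → List ℕ → Prop
  | two_two {l m : List ℕ} : (l, m) ∈ B → FirstReturn B (2 :: l) (2 :: m)
  | three_three {l m : List ℕ} : (l, m) ∈ B → FirstReturn B (3 :: l) (3 :: m)
  | two_three {l m : List ℕ} : Chain B false l m → FirstReturn B (2 :: l) (3 :: m)
  | three_two {l m : List ℕ} : Chain B false m l → FirstReturn B (3 :: l) (2 :: m)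

theorem FirstReturn.mem_balancedPairs {B : Set (List ℕ × List ℕ)} (hB : B ⊆ balancedPairs)
    {l m : List ℕ} (h : FirstReturn B l m) : (l, m) ∈ balancedPairs := by
  cases h with
  | two_two h =>
    obtain ⟨h1, h2, h3⟩ := hB h
    exact ⟨isTwoThree_cons.mpr ⟨.inl rfl, h1⟩, isTwoThree_cons.mpr ⟨.inl rfl, h2⟩, by
      simpa using h3⟩
  | three_three h =>
    obtain ⟨h1, h2, h3⟩ := hB h
    exact ⟨isTwoThree_cons.mpr ⟨.inr rfl, h1⟩, isTwoThree_cons.mpr ⟨.inr rfl, h2⟩, by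
      simpa using h3⟩
  | two_three h =>
    obtain ⟨h1, h2, h3⟩ := h.isTwoThree_and_sum hB
    refine ⟨isTwoThree_cons.mpr ⟨.inl rfl, h1⟩, isTwoThree_cons.mpr ⟨.inr rfl, h2⟩, ?_⟩
    simp at h3 ⊢
    omega
  | three_two h =>
    obtain ⟨h1, h2, h3⟩ := h.isTwoThree_and_sum hB
    refine ⟨isTwoThree_cons.mpr ⟨.inr rfl, h2⟩, isTwoThree_cons.mpr ⟨.inl rfl, h1⟩, ?_⟩
    simp at h3 ⊢
    omega

theorem balancedPairs_unfold {l m : List ℕ} (h : (l, m) ∈ balancedPairs) :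
    (l = [] ∧ m = []) ∨ FirstReturn balancedPairs l m := by
  obtain ⟨hl, hm, h⟩ := h
  dsimp only at hl hm h
  rcases Nat.eq_zero_or_pos l.sum with h0 | h0
  · exact .inl ⟨hl.eq_nil h0, hm.eq_nil (h ▸ h0)⟩
  · right
    obtain ⟨l', hl', rfl | rfl⟩ := hl.exists_cons h0 <;>
    obtain ⟨m', hm', rfl | rfl⟩ := hm.exists_cons (h ▸ h0) <;>
    simp only [List.sum_cons] at h
    · exact .two_two ⟨hl', hm', by dsimp only; omega⟩
    · exact .two_three (Chain.of_sum hl' hm' (by simp; omega))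
    · exact .three_two (Chain.of_sum hm' hl' (by simp; omega))
    · exact .three_three ⟨hl', hm', by dsimp only; omega⟩

/-- Inflating all blocks by the factor `c` multiplies the index by `c`. -/
theorem pairIndex_eq_mul (c k : ℕ) :
    (∀ p : List ℕ × List ℕ, p.1.length + p.2.length ≤ k → p ∈ balancedPairs →
      pairIndex₀ c p = c * pairIndex₀ 1 p) ∧
    (∀ l m : List ℕ, l.length + m.length ≤ k → Chain balancedPairs false l m →
      pairIndex₁ c (l, m) = c * pairIndex₁ 1 (l, m)) ∧
    (∀ l m : List ℕ, l.length + m.length ≤ k → Chain balancedPairs true l m →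
      pairIndex₂ c (l, m) = c * pairIndex₂ 1 (l, m)) := by
  -- The three states feed into one another, so they are treated together by induction on the total
  -- number of blocks.
  induction k using Nat.strong_induction_on with
  | _ k ih =>
  have ih0 : ∀ l m : List ℕ, l.length + m.length < k → (l, m) ∈ balancedPairs →
      pairIndex₀ c (l, m) = c * pairIndex₀ 1 (l, m) :=
    fun l m h h' => (ih _ h).1 (l, m) le_rfl h'
  have ih1 : ∀ l m : List ℕ, l.length + m.length < k → Chain balancedPairs false l m →
      pairIndex₁ c (l, m) = c * pairIndex₁ 1 (l, m) :=
    fun l m h h' => (ih _ h).2.1 l m le_rfl h'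
  have ih2 : ∀ l m : List ℕ, l.length + m.length < k → Chain balancedPairs true l m →
      pairIndex₂ c (l, m) = c * pairIndex₂ 1 (l, m) :=
    fun l m h h' => (ih _ h).2.2 l m le_rfl h'
  have hs : ∀ {b : Bool} {l m : List ℕ}, Chain balancedPairs b l m →
      l.sum = m.sum + (if b then 2 else 1) := fun h => (h.isTwoThree_and_sum subset_rfl).2.2
  refine ⟨?_, ?_, ?_⟩
  · rintro ⟨l, m⟩ hk hp
    rcases balancedPairs_unfold hp with ⟨rfl, rfl⟩ | h
    · rw [pairIndex₀_nil, pairIndex₀_nil, mul_zero]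
    · cases h with
      | two_two h =>
        simp only [List.length_cons] at hk
        rw [pairIndex₀_two_two, pairIndex₀_two_two, ih0 _ _ (by omega) h]
        ring
      | three_three h =>
        simp only [List.length_cons] at hk
        rw [pairIndex₀_three_three, pairIndex₀_three_three, ih0 _ _ (by omega) h]
        ring
      | two_three h =>
        simp only [List.length_cons] at hk
        rw [pairIndex₀_two_three _ (hs h), pairIndex₀_two_three _ (hs h), ih1 _ _ (by omega) h]
      | three_two h =>
        simp only [List.length_cons] at hk
        rw [pairIndex₀_three_two _ (hs h), pairIndex₀_three_two _ (hs h), ih1 _ _ (by omega) h]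
  · intro l m hk h
    cases h with
    | one_two h =>
      simp only [List.length_cons] at hk
      rw [pairIndex₁_two _ (hs h), pairIndex₁_two _ (hs h), ih1 _ _ (by omega) h]
    | one_three h =>
      simp only [List.length_cons] at hk
      rw [pairIndex₁_three _ (hs h), pairIndex₁_three _ (hs h), ih2 _ _ (by omega) h]
  · intro l m hk h
    cases h with
    | two_two h =>
      simp only [List.length_cons] at hk
      rw [pairIndex₂_two _ h.2.2, pairIndex₂_two _ h.2.2, ih0 _ _ (by omega) h]
      ring
    | two_three h =>
      simp only [List.length_cons] at hk
      rw [pairIndex₂_three _ (hs h), pairIndex₂_three _ (hs h), ih1 _ _ (by omega) h]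
      ring

end TwoThree

/-! ### The linear system of generating functions -/

section GenFun

/-- The generating function of a set of pairs of lists, where `x` marks the sum of the first list
and `y` marks the weight `w`. -/
noncomputable def pairGenFun (T : Set (List ℕ × List ℕ)) (w : List ℕ × List ℕ → ℕ) :
    MvPowerSeries (Fin 2) ℚ :=
  fun d => (Set.ncard {p | p ∈ T ∧ p.1.sum = d 0 ∧ w p = d 1} : ℚ)

theorem coeff_pairGenFun (T : Set (List ℕ × List ℕ)) (w : List ℕ × List ℕ → ℕ)
    (d : Fin 2 →₀ ℕ) : MvPowerSeries.coeff d (pairGenFun T w) =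
      (Set.ncard {p | p ∈ T ∧ p.1.sum = d 0 ∧ w p = d 1} : ℚ) := rfl

theorem finite_isTwoThree_sum_le (n : ℕ) : {l : List ℕ | IsTwoThree l ∧ l.sum ≤ n}.Finite := by
  refine ((Set.finite_Iic n).biUnion fun k _ =>
    Set.finite_range (Composition.blocks : Composition k → List ℕ)).subset ?_
  rintro l ⟨hl, hn⟩
  refine Set.mem_biUnion (x := l.sum) hn ⟨⟨l, fun {i} hi => ?_, rfl⟩, rfl⟩
  rcases hl i hi with h | h <;> omega

/-- Pairs of lists with entries `2` and `3` whose first sum is at least the second one. -/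
def dominatedPairs : Set (List ℕ × List ℕ) :=
  {p | IsTwoThree p.1 ∧ IsTwoThree p.2 ∧ p.2.sum ≤ p.1.sum}

theorem finite_dominatedPairs {T : Set (List ℕ × List ℕ)} (hT : T ⊆ dominatedPairs)
    (w : List ℕ × List ℕ → ℕ) (n k : ℕ) : {p | p ∈ T ∧ p.1.sum = n ∧ w p = k}.Finite := by
  refine ((finite_isTwoThree_sum_le n).prod (finite_isTwoThree_sum_le n)).subset ?_
  rintro p ⟨hp, hn, -⟩
  obtain ⟨h1, h2, h3⟩ := hT hp
  exact ⟨⟨h1, hn.le⟩, ⟨h2, h3.trans hn.le⟩⟩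

theorem pairGenFun_union {S T : Set (List ℕ × List ℕ)} (hS : S ⊆ dominatedPairs)
    (hT : T ⊆ dominatedPairs) (h : Disjoint S T) (w : List ℕ × List ℕ → ℕ) :
    pairGenFun (S ∪ T) w = pairGenFun S w + pairGenFun T w := by
  ext d
  rw [map_add, coeff_pairGenFun, coeff_pairGenFun, coeff_pairGenFun, ← Nat.cast_add,
    ← Set.ncard_union_eq _ (finite_dominatedPairs hS w _ _) (finite_dominatedPairs hT w _ _)]
  · congr 2
    ext p
    simp only [Set.mem_ofPred_eq, Set.mem_union]
    tauto
  · rw [Set.disjoint_left] at h ⊢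
    exact fun p hp hp' => h hp.1 hp'.1

theorem X_pow_mul_X_pow (a b : ℕ) : (MvPowerSeries.X 0 : MvPowerSeries (Fin 2) ℚ) ^ a *
    MvPowerSeries.X 1 ^ b =
      MvPowerSeries.monomial (Finsupp.single 0 a + Finsupp.single 1 b) 1 := by
  rw [MvPowerSeries.X_pow_eq, MvPowerSeries.X_pow_eq, MvPowerSeries.monomial_mul_monomial, mul_one]

theorem coeff_X_pow_mul (a b : ℕ) (f : MvPowerSeries (Fin 2) ℚ) (d : Fin 2 →₀ ℕ) :
    MvPowerSeries.coeff d (MvPowerSeries.X 0 ^ a * MvPowerSeries.X 1 ^ b * f) =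
      if a ≤ d 0 ∧ b ≤ d 1 then
        MvPowerSeries.coeff (d - (Finsupp.single 0 a + Finsupp.single 1 b)) f else 0 := by
  rw [X_pow_mul_X_pow, MvPowerSeries.coeff_monomial_mul, one_mul]
  have : Finsupp.single 0 a + Finsupp.single 1 b ≤ d ↔ a ≤ d 0 ∧ b ≤ d 1 := by
    rw [Finsupp.le_def, Fin.forall_fin_two]
    simp
  simp only [this]

theorem pairGenFun_image {T : Set (List ℕ × List ℕ)} {f : List ℕ × List ℕ → List ℕ × List ℕ}
    (hf : Function.Injective f) {w w' : List ℕ × List ℕ → ℕ} {a b : ℕ}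
    (hsum : ∀ p ∈ T, (f p).1.sum = p.1.sum + a) (hw : ∀ p ∈ T, w' (f p) = w p + b) :
    pairGenFun (f '' T) w' =
      MvPowerSeries.X 0 ^ a * MvPowerSeries.X 1 ^ b * pairGenFun T w := by
  ext d
  rw [coeff_X_pow_mul, coeff_pairGenFun]
  split_ifs with h
  · rw [coeff_pairGenFun]
    refine Eq.trans ?_ (congrArg Nat.cast (Set.ncard_image_of_injective _ hf))
    congr 2
    ext q
    simp only [Set.mem_ofPred_eq, Set.mem_image, Finsupp.tsub_apply, Finsupp.add_apply,
      Finsupp.single_eq_same, Finsupp.single_eq_of_ne zero_ne_one,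
      Finsupp.single_eq_of_ne one_ne_zero, add_zero, zero_add]
    constructor
    · rintro ⟨⟨p, hp, rfl⟩, h1, h2⟩
      rw [hsum p hp] at h1
      rw [hw p hp] at h2
      exact ⟨p, ⟨hp, by omega, by omega⟩, rfl⟩
    · rintro ⟨p, ⟨hp, h1, h2⟩, rfl⟩
      rw [hsum p hp, hw p hp]
      exact ⟨⟨p, hp, rfl⟩, by omega, by omega⟩
  · rw [Nat.cast_eq_zero]
    refine (congrArg Set.ncard (Set.eq_empty_iff_forall_notMem.mpr ?_)).trans (Set.ncard_empty _)
    rintro q ⟨⟨p, hp, rfl⟩, h1, h2⟩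
    rw [hsum p hp] at h1
    rw [hw p hp] at h2
    omega

theorem pairGenFun_nil : pairGenFun {([], [])} (pairIndex₀ 1) = 1 := by
  ext d
  rw [coeff_pairGenFun, MvPowerSeries.coeff_one]
  have hd : d = 0 ↔ d 0 = 0 ∧ d 1 = 0 := by
    rw [Finsupp.ext_iff, Fin.forall_fin_two]
    rfl
  split_ifs with h
  · subst h
    have : {p : List ℕ × List ℕ | p ∈ ({([], [])} : Set (List ℕ × List ℕ)) ∧
        p.1.sum = (0 : Fin 2 →₀ ℕ) 0 ∧ pairIndex₀ 1 p = (0 : Fin 2 →₀ ℕ) 1} = {([], [])} := by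
      ext p
      simp only [Set.mem_ofPred_eq, Set.mem_singleton_iff, Finsupp.coe_zero, Pi.zero_apply]
      refine ⟨fun h => h.1, ?_⟩
      rintro rfl
      exact ⟨rfl, rfl, pairIndex₀_nil 1⟩
    rw [this, Set.ncard_singleton, Nat.cast_one]
  · rw [Nat.cast_eq_zero]
    refine (congrArg Set.ncard (Set.eq_empty_iff_forall_notMem.mpr ?_)).trans (Set.ncard_empty _)
    rintro q ⟨rfl, h1, h2⟩
    rw [pairIndex₀_nil] at h2
    exact h (hd.mpr ⟨h1.symm, h2.symm⟩)

/-- Adding a first entry to the smaller of two lists, which then becomes the first component. -/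
def consSwap (a : ℕ) (p : List ℕ × List ℕ) : List ℕ × List ℕ := (a :: p.2, p.1)

/-- Adding a first entry to both lists. -/
def consCons (a b : ℕ) (p : List ℕ × List ℕ) : List ℕ × List ℕ := (a :: p.1, b :: p.2)

theorem consSwap_injective (a : ℕ) : Function.Injective (consSwap a) := by
  rintro ⟨l, m⟩ ⟨l', m'⟩ h
  simp only [consSwap, Prod.mk.injEq, List.cons.injEq, true_and] at h
  rw [h.1, h.2]

theorem consCons_injective (a b : ℕ) : Function.Injective (consCons a b) := by
  rintro ⟨l, m⟩ ⟨l', m'⟩ h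
  simp only [consCons, Prod.mk.injEq, List.cons.injEq, true_and] at h
  rw [h.1, h.2]

theorem swap_consCons_injective (a b : ℕ) :
    Function.Injective fun p : List ℕ × List ℕ => consCons a b p.swap :=
  (consCons_injective a b).comp Prod.swap_injective

/-- The pairs of lists that are connected by a chain. -/
def chainSet (B : Set (List ℕ × List ℕ)) (b : Bool) : Set (List ℕ × List ℕ) :=
  {p | Chain B b p.1 p.2}

/-- The pairs of lists with first return in `B`. -/
def firstReturnSet (B : Set (List ℕ × List ℕ)) : Set (List ℕ × List ℕ) :=
  {p | FirstReturn B p.1 p.2}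

variable {B : Set (List ℕ × List ℕ)}

theorem chainSet_subset (hB : B ⊆ balancedPairs) (b : Bool) : chainSet B b ⊆ dominatedPairs := by
  intro p hp
  obtain ⟨h1, h2, h3⟩ := hp.isTwoThree_and_sum hB
  exact ⟨h1, h2, by omega⟩

theorem balancedPairs_subset : balancedPairs ⊆ dominatedPairs :=
  fun _ h => ⟨h.1, h.2.1, h.2.2.ge⟩

theorem firstReturnSet_subset (hB : B ⊆ balancedPairs) : firstReturnSet B ⊆ balancedPairs :=
  fun _ h => h.mem_balancedPairs hB

theorem chainSet_sum (hB : B ⊆ balancedPairs) {b : Bool} {p : List ℕ × List ℕ}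
    (hp : p ∈ chainSet B b) : p.1.sum = p.2.sum + (if b then 2 else 1) :=
  (hp.isTwoThree_and_sum hB).2.2

theorem chainSet_false (B : Set (List ℕ × List ℕ)) : chainSet B false =
    consSwap 2 '' chainSet B false ∪ consSwap 3 '' chainSet B true := by
  ext ⟨l, m⟩
  constructor
  · intro h
    cases h with
    | one_two h => exact .inl ⟨(_, _), h, rfl⟩
    | one_three h => exact .inr ⟨(_, _), h, rfl⟩
  · rintro (⟨⟨l', m'⟩, h, h'⟩ | ⟨⟨l', m'⟩, h, h'⟩) <;> obtain ⟨rfl, rfl⟩ := Prod.mk.inj h'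
    · exact .one_two h
    · exact .one_three h

theorem chainSet_true (B : Set (List ℕ × List ℕ)) : chainSet B true =
    consSwap 2 '' B ∪ consSwap 3 '' chainSet B false := by
  ext ⟨l, m⟩
  constructor
  · intro h
    cases h with
    | two_two h => exact .inl ⟨(_, _), h, rfl⟩
    | two_three h => exact .inr ⟨(_, _), h, rfl⟩
  · rintro (⟨⟨l', m'⟩, h, h'⟩ | ⟨⟨l', m'⟩, h, h'⟩) <;> obtain ⟨rfl, rfl⟩ := Prod.mk.inj h'
    · exact .two_two h
    · exact .two_three h

theorem firstReturnSet_eq (B : Set (List ℕ × List ℕ)) : firstReturnSet B =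
    ((consCons 2 2 '' B ∪ consCons 3 3 '' B) ∪ consCons 2 3 '' chainSet B false) ∪
      (fun p => consCons 3 2 p.swap) '' chainSet B false := by
  ext ⟨l, m⟩
  constructor
  · intro h
    cases h with
    | two_two h => exact .inl (.inl (.inl ⟨(_, _), h, rfl⟩))
    | three_three h => exact .inl (.inl (.inr ⟨(_, _), h, rfl⟩))
    | two_three h => exact .inl (.inr ⟨(_, _), h, rfl⟩)
    | three_two h => exact .inr ⟨(_, _), h, rfl⟩
  · rintro (((⟨⟨l', m'⟩, h, h'⟩ | ⟨⟨l', m'⟩, h, h'⟩) | ⟨⟨l', m'⟩, h, h'⟩) | ⟨⟨l', m'⟩, h, h'⟩) <;>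
      obtain ⟨rfl, rfl⟩ := Prod.mk.inj h'
    · exact .two_two h
    · exact .three_three h
    · exact .two_three h
    · exact .three_two h

theorem disjoint_consSwap (S T : Set (List ℕ × List ℕ)) :
    Disjoint (consSwap 2 '' S) (consSwap 3 '' T) := by
  rw [Set.disjoint_left]
  rintro _ ⟨p, -, rfl⟩ ⟨q, -, h⟩
  simp [consSwap] at h

/-- With one pending block 1, either next part raises the larger sum by one and leaves the index
unchanged. -/
theorem pairGenFun_chainSet_false (hB : B ⊆ balancedPairs) :
    pairGenFun (chainSet B false) (pairIndex₁ 1) =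
      MvPowerSeries.X 0 ^ 1 * MvPowerSeries.X 1 ^ 0 * pairGenFun (chainSet B false) (pairIndex₁ 1) +
        MvPowerSeries.X 0 ^ 1 * MvPowerSeries.X 1 ^ 0 *
          pairGenFun (chainSet B true) (pairIndex₂ 1) := by
  have h1 := chainSet_false B
  have h2 := chainSet_subset hB false
  rw [h1, Set.union_subset_iff] at h2
  conv_lhs => rw [h1, pairGenFun_union h2.1 h2.2 (disjoint_consSwap _ _)]
  congr 1
  · refine pairGenFun_image (consSwap_injective 2) (fun p hp => ?_) (fun p hp => ?_)
    · have := chainSet_sum hB hp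
      simp [consSwap] at this ⊢
      omega
    · exact pairIndex₁_two 1 (chainSet_sum hB hp)
  · refine pairGenFun_image (consSwap_injective 3) (fun p hp => ?_) (fun p hp => ?_)
    · have := chainSet_sum hB hp
      simp [consSwap] at this ⊢
      omega
    · exact pairIndex₁_three 1 (chainSet_sum hB hp)

/-- With two pending blocks 1, the reduction creates equal leading blocks 1. Splitting them off
raises the index by one, whence the factor `y`. -/
theorem pairGenFun_chainSet_true (hB : B ⊆ balancedPairs) :
    pairGenFun (chainSet B true) (pairIndex₂ 1) =
      MvPowerSeries.X 0 ^ 2 * MvPowerSeries.X 1 ^ 1 * pairGenFun B (pairIndex₀ 1) +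
        MvPowerSeries.X 0 ^ 2 * MvPowerSeries.X 1 ^ 1 *
          pairGenFun (chainSet B false) (pairIndex₁ 1) := by
  have h1 := chainSet_true B
  have h2 := chainSet_subset hB true
  rw [h1, Set.union_subset_iff] at h2
  rw [h1, pairGenFun_union h2.1 h2.2 (disjoint_consSwap _ _)]
  congr 1
  · refine pairGenFun_image (consSwap_injective 2) (fun p hp => ?_) (fun p hp => ?_)
    · have := (hB hp).2.2
      simp [consSwap]
      omega
    · exact pairIndex₂_two 1 (hB hp).2.2
  · refine pairGenFun_image (consSwap_injective 3) (fun p hp => ?_) (fun p hp => ?_)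
    · have := chainSet_sum hB hp
      simp [consSwap] at this ⊢
      omega
    · exact pairIndex₂_three 1 (chainSet_sum hB hp)

theorem pairGenFun_firstReturnSet (hB : B ⊆ balancedPairs) :
    pairGenFun (firstReturnSet B) (pairIndex₀ 1) =
      MvPowerSeries.X 0 ^ 2 * MvPowerSeries.X 1 ^ 2 * pairGenFun B (pairIndex₀ 1) +
        MvPowerSeries.X 0 ^ 3 * MvPowerSeries.X 1 ^ 3 * pairGenFun B (pairIndex₀ 1) +
        MvPowerSeries.X 0 ^ 2 * MvPowerSeries.X 1 ^ 0 *
          pairGenFun (chainSet B false) (pairIndex₁ 1) +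
        MvPowerSeries.X 0 ^ 2 * MvPowerSeries.X 1 ^ 0 *
          pairGenFun (chainSet B false) (pairIndex₁ 1) := by
  have h1 := firstReturnSet_eq B
  have h2 := (firstReturnSet_subset hB).trans balancedPairs_subset
  rw [h1] at h2
  have h3 := Set.union_subset_iff.mp h2
  have h4 := Set.union_subset_iff.mp h3.1
  have h5 := Set.union_subset_iff.mp h4.1
  rw [h1, pairGenFun_union h3.1 h3.2, pairGenFun_union h4.1 h4.2, pairGenFun_union h5.1 h5.2]
  · congr 1
    · congr 1
      · congr 1
        · exact pairGenFun_image (consCons_injective 2 2)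
            (fun p _ => by simp [consCons, add_comm]) (fun p _ => pairIndex₀_two_two 1)
        · exact pairGenFun_image (consCons_injective 3 3)
            (fun p _ => by simp [consCons, add_comm]) (fun p _ => pairIndex₀_three_three 1)
      · exact pairGenFun_image (consCons_injective 2 3)
          (fun p _ => by simp [consCons, add_comm])
          (fun p hp => pairIndex₀_two_three 1 (chainSet_sum hB hp))
    · refine pairGenFun_image (swap_consCons_injective 3 2) (fun p hp => ?_)
        (fun p hp => pairIndex₀_three_two 1 (chainSet_sum hB hp))
      have := chainSet_sum hB hp
      simp [consCons] at this ⊢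
      omega
  · rw [Set.disjoint_left]
    rintro _ ⟨p, -, rfl⟩ ⟨q, -, h⟩
    simp [consCons] at h
  · rw [Set.disjoint_left]
    rintro _ (⟨p, -, rfl⟩ | ⟨p, -, rfl⟩) ⟨q, -, h⟩ <;> simp [consCons] at h
  · rw [Set.disjoint_left]
    rintro _ ((⟨p, -, rfl⟩ | ⟨p, -, rfl⟩) | ⟨p, -, rfl⟩) ⟨q, -, h⟩ <;> simp [consCons] at h

/-- The generating function of first returns, multiplied by the denominator of the walk. -/
theorem pairGenFun_firstReturnSet_mul (hB : B ⊆ balancedPairs) {x y : MvPowerSeries (Fin 2) ℚ}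
    (hx : x = MvPowerSeries.X 0) (hy : y = MvPowerSeries.X 1) :
    pairGenFun (firstReturnSet B) (pairIndex₀ 1) * (1 - x - x ^ 3 * y) =
      ((x ^ 2 * y ^ 2 + x ^ 3 * y ^ 3) * (1 - x - x ^ 3 * y) + 2 * x ^ 5 * y) *
        pairGenFun B (pairIndex₀ 1) := by
  have h1 := pairGenFun_chainSet_false hB
  have h2 := pairGenFun_chainSet_true hB
  have h3 := pairGenFun_firstReturnSet hB
  rw [← hx, ← hy] at h1 h2 h3
  rw [h2] at h1
  rw [h3]
  -- After substitution, `h1` says that the series of chains of excess 1 times `1 - x - x³y` is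
  -- `x³y` times that of `B`. The factor `2 x²` counts the two mirror-image first steps with unequal
  -- parts.
  linear_combination (2 * x ^ 2) * h1

end GenFun

/-! ### Meanders as balanced pairs, and inflation -/

section Counting

/-- The pair of block lists of a meander. -/
def Meander.blockPair {n : ℕ} (M : Meander n) : List ℕ × List ℕ := (M.top.blocks, M.bot.blocks)

theorem Meander.blockPair_injective {n : ℕ} :
    Function.Injective (Meander.blockPair : Meander n → List ℕ × List ℕ) := by
  intro M M' h
  obtain ⟨h1, h2⟩ := Prod.mk.inj h
  exact Meander.ext (Composition.ext h1) (Composition.ext h2)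

/-- Multiplication of all entries of two lists by `c`. -/
def inflatePair (c : ℕ) (p : List ℕ × List ℕ) : List ℕ × List ℕ :=
  (p.1.map (c * ·), p.2.map (c * ·))

theorem inflatePair_injective {c : ℕ} (hc : 0 < c) : Function.Injective (inflatePair c) := by
  have h : Function.Injective (List.map (c * ·)) :=
    List.map_injective_iff.mpr fun a b hab => Nat.eq_of_mul_eq_mul_left hc hab
  rintro ⟨l, m⟩ ⟨l', m'⟩ hp
  obtain ⟨h1, h2⟩ := Prod.mk.inj hp
  exact Prod.ext (h h1) (h h2)

theorem sum_map_mul_left (c : ℕ) (l : List ℕ) : (l.map (c * ·)).sum = c * l.sum := by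
  induction l with
  | nil => rfl
  | cons a l ih => rw [List.map_cons, List.sum_cons, List.sum_cons, ih, mul_add]

theorem exists_isTwoThree_map {c : ℕ} {l : List ℕ} (h : ∀ p ∈ l, p ∈ ({2 * c, 3 * c} : Set ℕ)) :
    ∃ l', IsTwoThree l' ∧ l = l'.map (c * ·) := by
  induction l with
  | nil => exact ⟨[], isTwoThree_nil, rfl⟩
  | cons a l ih =>
    obtain ⟨ha, hl⟩ := List.forall_mem_cons.mp h
    obtain ⟨l', h1, rfl⟩ := ih hl
    rcases ha with rfl | ha
    · exact ⟨2 :: l', isTwoThree_cons.mpr ⟨.inl rfl, h1⟩, by rw [List.map_cons, mul_comm]⟩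
    · rw [Set.mem_singleton_iff] at ha
      subst ha
      exact ⟨3 :: l', isTwoThree_cons.mpr ⟨.inr rfl, h1⟩, by rw [List.map_cons, mul_comm]⟩

/-- The composition with blocks `c * l`. -/
def inflatedComposition {c : ℕ} (hc : 0 < c) {l : List ℕ} (hl : IsTwoThree l) {n : ℕ}
    (hn : l.sum * c = n) : Composition n where
  blocks := l.map (c * ·)
  blocks_pos := by
    intro i hi
    obtain ⟨a, ha, rfl⟩ := List.mem_map.mp hi
    rcases hl a ha with rfl | rfl <;> positivity
  blocks_sum := by rw [sum_map_mul_left, mul_comm, hn]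

theorem inflatedComposition_blocks_mem {c : ℕ} {l : List ℕ} (hl : IsTwoThree l) :
    ∀ p ∈ l.map (c * ·), p ∈ ({2 * c, 3 * c} : Set ℕ) := by
  intro p hp
  obtain ⟨a, ha, rfl⟩ := List.mem_map.mp hp
  rcases hl a ha with rfl | rfl
  · exact .inl (mul_comm _ _)
  · exact .inr (mul_comm _ _)

/-- Meanders with parts `2c` and `3c` correspond to balanced pairs. -/
theorem ncard_meander_eq {c : ℕ} (hc : 0 < c) (n k : ℕ) (P : Meander n → Prop)
    (T : Set (List ℕ × List ℕ)) (hT : T ⊆ balancedPairs)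
    (hPT : ∀ (M : Meander n) (p : List ℕ × List ℕ), p ∈ balancedPairs →
      M.blockPair = inflatePair c p → (P M ↔ p ∈ T)) :
    Set.ncard {M : Meander n | P M ∧ M.HasPartsIn {2 * c, 3 * c} ∧ M.ind = k} =
      Set.ncard {p | p ∈ T ∧ c * p.1.sum = n ∧ c * pairIndex₀ 1 p = k} := by
  have hind : ∀ (M : Meander n) (p : List ℕ × List ℕ), p ∈ balancedPairs →
      M.blockPair = inflatePair c p → c * p.1.sum = n ∧ M.ind = c * pairIndex₀ 1 p := by
    intro M p hp h
    obtain ⟨h1, h2⟩ := Prod.mk.inj h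
    have hn : p.1.sum * c = n := by rw [← M.top.blocks_sum, h1, sum_map_mul_left, mul_comm]
    subst hn
    refine ⟨mul_comm _ _, ?_⟩
    rw [M.ind_eq_listIndex hc h1 h2, ← (pairIndex_eq_mul c _).1 p le_rfl hp]
    rfl
  -- Both sets embed into pairs of block lists, meanders by their blocks and balanced pairs by
  -- inflation; the two images coincide.
  rw [← Set.ncard_image_of_injective _ Meander.blockPair_injective,
    ← Set.ncard_image_of_injective {p | p ∈ T ∧ _} (inflatePair_injective hc)]
  congr 1
  ext q
  constructor
  · rintro ⟨M, ⟨hP, ⟨h1, h2⟩, hk⟩, rfl⟩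
    obtain ⟨l, hl, hl'⟩ := exists_isTwoThree_map h1
    obtain ⟨m, hm, hm'⟩ := exists_isTwoThree_map h2
    have hp : (l, m) ∈ balancedPairs := by
      refine ⟨hl, hm, Nat.eq_of_mul_eq_mul_left hc ?_⟩
      dsimp only
      rw [← sum_map_mul_left, ← sum_map_mul_left, ← hl', ← hm', M.top.blocks_sum,
        M.bot.blocks_sum]
    have hb : M.blockPair = inflatePair c (l, m) := Prod.ext hl' hm'
    obtain ⟨h3, h4⟩ := hind M _ hp hb
    exact ⟨(l, m), ⟨(hPT M _ hp hb).mp hP, h3, h4 ▸ hk⟩, hb.symm⟩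
  · rintro ⟨p, ⟨hp, hn, hk⟩, rfl⟩
    have hp' := hT hp
    let M : Meander n := ⟨inflatedComposition hc hp'.1 (by rw [mul_comm, hn]),
      inflatedComposition hc hp'.2.1 (by rw [← hp'.2.2, mul_comm, hn])⟩
    have hb : M.blockPair = inflatePair c p := rfl
    refine ⟨M, ⟨(hPT M p hp' hb).mpr hp, ⟨inflatedComposition_blocks_mem hp'.1,
      inflatedComposition_blocks_mem hp'.2.1⟩, ?_⟩, hb⟩
    rw [(hind M p hp' hb).2, hk]

theorem meanderCount_eq {c : ℕ} (hc : 0 < c) (n k : ℕ) :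
    meanderCount {2 * c, 3 * c} n k =
      Set.ncard {p | p ∈ balancedPairs ∧ c * p.1.sum = n ∧ c * pairIndex₀ 1 p = k} := by
  rw [← ncard_meander_eq hc n k (fun _ => True) balancedPairs subset_rfl
    fun _ _ hp _ => iff_of_true trivial hp]
  simp only [true_and]
  rfl

theorem meanderGenFun_two_three :
    meanderGenFun {2, 3} = pairGenFun balancedPairs (pairIndex₀ 1) := by
  ext d
  have := meanderCount_eq one_pos (d 0) (d 1)
  simp only [mul_one, one_mul] at this
  rw [coeff_pairGenFun, ← this]
  rfl

/-- Node number and index are both multiplied by `c`, so coefficients at exponents not divisible by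
`c` vanish on both sides. -/
theorem meanderGenFun_inflate {c : ℕ} (hc : c ≠ 0) :
    meanderGenFun {2 * c, 3 * c} = MvPowerSeries.expand c hc (meanderGenFun {2, 3}) := by
  have hc' := Nat.pos_of_ne_zero hc
  ext d
  have h0 : MvPowerSeries.coeff d (meanderGenFun {2 * c, 3 * c}) =
      (Set.ncard {p | p ∈ balancedPairs ∧ c * p.1.sum = d 0 ∧ c * pairIndex₀ 1 p = d 1} : ℚ) :=
    congrArg Nat.cast (meanderCount_eq hc' (d 0) (d 1))
  rw [h0]
  by_cases h : ∀ i, c ∣ d i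
  · obtain ⟨e, rfl⟩ : ∃ e : Fin 2 →₀ ℕ, d = c • e := by
      refine ⟨d.mapRange (· / c) (Nat.zero_div c), ?_⟩
      ext i
      simp [Nat.mul_div_cancel' (h i)]
    rw [MvPowerSeries.coeff_expand_smul, meanderGenFun_two_three, coeff_pairGenFun]
    simp only [Finsupp.smul_apply, smul_eq_mul, Nat.mul_right_inj hc]
  · push Not at h
    obtain ⟨i, hi⟩ := h
    rw [MvPowerSeries.coeff_expand_of_not_dvd c hc _ hi, Nat.cast_eq_zero]
    refine (congrArg Set.ncard (Set.eq_empty_iff_forall_notMem.mpr ?_)).trans (Set.ncard_empty _)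
    rintro p ⟨-, h1, h2⟩
    fin_cases i
    · exact hi ⟨_, h1.symm⟩
    · exact hi ⟨_, h2.symm⟩

/-- Cutting a nonempty pair at its first return leaves another balanced pair. This self-reference is
what makes the generating function rational. -/
theorem balancedPairs_eq : balancedPairs = {([], [])} ∪ firstReturnSet balancedPairs := by
  ext ⟨l, m⟩
  constructor
  · intro h
    rcases balancedPairs_unfold h with ⟨rfl, rfl⟩ | h
    · exact .inl rfl
    · exact .inr h
  · rintro (h | h)
    · obtain ⟨rfl, rfl⟩ := Prod.mk.inj h
      exact ⟨isTwoThree_nil, isTwoThree_nil, rfl⟩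
    · exact h.mem_balancedPairs subset_rfl

theorem nil_subset_balancedPairs : {([], [])} ⊆ balancedPairs := by
  rw [balancedPairs_eq]
  exact Set.subset_union_left

theorem pairGenFun_balancedPairs : pairGenFun balancedPairs (pairIndex₀ 1) =
    1 + pairGenFun (firstReturnSet balancedPairs) (pairIndex₀ 1) := by
  conv_lhs => rw [balancedPairs_eq]
  rw [pairGenFun_union (nil_subset_balancedPairs.trans balancedPairs_subset)
    ((firstReturnSet_subset subset_rfl).trans balancedPairs_subset), pairGenFun_nil]
  rw [Set.disjoint_singleton_left]
  intro h
  cases h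

end Counting

/-! ### Indecomposable meanders as walks that return only at the end -/

section Indecomposable

/-- Decomposability of a pair of lists with equal sums `n`. -/
def ListDecomposable (n : ℕ) (l m : List ℕ) : Prop :=
  ∃ l₁ l₂ m₁ m₂ : List ℕ, l = l₁ ++ l₂ ∧ m = m₁ ++ m₂ ∧ l₁.sum = m₁.sum ∧ l₁.sum < n ∧ l₂.sum < n

theorem Meander.decomposable_iff {n : ℕ} (M : Meander n) :
    M.Decomposable ↔ ListDecomposable n M.top.blocks M.bot.blocks := by
  constructor
  · rintro ⟨a, b, M₁, M₂, ha, hb, h1, h2⟩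
    refine ⟨_, _, _, _, h1, h2, ?_, ?_, ?_⟩
    · rw [M₁.top.blocks_sum, M₁.bot.blocks_sum]
    · rwa [M₁.top.blocks_sum]
    · rwa [M₂.top.blocks_sum]
  · rintro ⟨l₁, l₂, m₁, m₂, h1, h2, h3, h4, h5⟩
    have hl := M.top.blocks_sum
    have hm := M.bot.blocks_sum
    rw [h1, List.sum_append] at hl
    rw [h2, List.sum_append] at hm
    have hlpos : ∀ i ∈ l₁ ++ l₂, 0 < i := fun i hi => M.top.blocks_pos (h1 ▸ hi)
    have hmpos : ∀ i ∈ m₁ ++ m₂, 0 < i := fun i hi => M.bot.blocks_pos (h2 ▸ hi)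
    exact ⟨l₁.sum, l₂.sum,
      ⟨⟨l₁, fun hi => hlpos _ (List.mem_append_left _ hi), rfl⟩,
        ⟨m₁, fun hi => hmpos _ (List.mem_append_left _ hi), h3.symm⟩⟩,
      ⟨⟨l₂, fun hi => hlpos _ (List.mem_append_right _ hi), rfl⟩,
        ⟨m₂, fun hi => hmpos _ (List.mem_append_right _ hi), by omega⟩⟩, h4, h5, h1, h2⟩

/-- The only prefixes of `l` and `m` whose sums have difference `e` are `l` and `m`. -/
def NoProperPrefix (e : ℕ) (l m : List ℕ) : Prop :=
  ∀ l₁ l₂ m₁ m₂ : List ℕ, l = l₁ ++ l₂ → m = m₁ ++ m₂ → l₁.sum = m₁.sum + e → l₂ = [] ∧ m₂ = []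

/-- A positive difference `e` forces the prefix of the first list to contain `a`; without `a`, the
other list is ahead by `e' = a - e`. -/
theorem noProperPrefix_cons {a e e' : ℕ} {l m : List ℕ} (h : NoProperPrefix e' m l) (hpos : 0 < e) (ha : a = e + e') :
    NoProperPrefix e (a :: l) m := by
  rintro (_ | ⟨b, l₁⟩) l₂ m₁ m₂ h1 h2 h3
  · rw [List.sum_nil] at h3
    omega
  · obtain ⟨rfl, rfl⟩ := List.cons.inj h1
    rw [List.sum_cons] at h3
    exact (h m₁ m₂ l₁ l₂ h2 rfl (by omega)).symm

theorem NoProperPrefix.tail {a e e' : ℕ} {l m : List ℕ} (h : NoProperPrefix e (a :: l) m)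
    (ha : a = e + e') : NoProperPrefix e' m l := by
  intro m₁ m₂ l₁ l₂ h1 h2 h3
  refine (h (a :: l₁) l₂ m₁ m₂ (by rw [h2]; rfl) h1 ?_).symm
  rw [List.sum_cons]
  omega

theorem noProperPrefix_nil (e : ℕ) : NoProperPrefix e [] [] := by
  intro l₁ l₂ m₁ m₂ h1 h2 _
  exact ⟨(List.append_eq_nil_iff.mp h1.symm).2, (List.append_eq_nil_iff.mp h2.symm).2⟩

theorem Chain.noProperPrefix {b : Bool} {l m : List ℕ} (h : Chain {([], [])} b l m) :
    NoProperPrefix (if b then 2 else 1) l m := by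
  induction h with
  | one_two _ ih => exact noProperPrefix_cons ih one_pos rfl
  | one_three _ ih => exact noProperPrefix_cons ih one_pos rfl
  | two_two h =>
    obtain ⟨rfl, rfl⟩ := Prod.mk.inj h
    exact noProperPrefix_cons (noProperPrefix_nil 0) two_pos rfl
  | two_three _ ih => exact noProperPrefix_cons ih two_pos rfl

theorem Chain.of_noProperPrefix {b : Bool} {l m : List ℕ} (hl : IsTwoThree l) (hm : IsTwoThree m)
    (h : l.sum = m.sum + (if b then 2 else 1)) (hp : NoProperPrefix (if b then 2 else 1) l m) :
    Chain {([], [])} b l m := by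
  refine Chain.of_unfold (C := fun b l m => IsTwoThree l ∧ IsTwoThree m ∧
    l.sum = m.sum + (if b then 2 else 1) ∧ NoProperPrefix (if b then 2 else 1) l m)
    ?_ ?_ ⟨hl, hm, h, hp⟩
  · rintro l m ⟨hl, hm, h, hp⟩
    simp only [Bool.false_eq_true, if_false] at h hp
    obtain ⟨l', hl', rfl | rfl⟩ := hl.exists_cons (by omega)
    · refine .inl ⟨l', rfl, hm, hl', ?_, hp.tail rfl⟩
      rw [List.sum_cons] at h
      simp
      omega
    · refine .inr ⟨l', rfl, hm, hl', ?_, hp.tail rfl⟩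
      rw [List.sum_cons] at h
      simp
      omega
  · rintro l m ⟨hl, hm, h, hp⟩
    simp only [if_true] at h hp
    obtain ⟨l', hl', rfl | rfl⟩ := hl.exists_cons (by omega)
    · refine .inl ⟨l', rfl, ?_⟩
      -- The prefixes `[2]` and `[]` already differ by the excess 2, so nothing may follow them.
      obtain ⟨rfl, rfl⟩ := hp [2] l' [] m rfl rfl rfl
      rfl
    · refine .inr ⟨l', rfl, hm, hl', ?_, hp.tail rfl⟩
      rw [List.sum_cons] at h
      simp
      omega

/-- A decomposition is a pair of nonempty proper prefixes with equal sums. Dropping the first parts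
turns equality of sums into difference 0 or 1, which `NoProperPrefix` controls along the chain. -/
theorem firstReturn_nil_iff {l m : List ℕ} (h : (l, m) ∈ balancedPairs) :
    FirstReturn {([], [])} l m ↔ 0 < l.sum ∧ ¬ ListDecomposable l.sum l m := by
  obtain ⟨hl, hm, hlm⟩ := h
  dsimp only at hl hm hlm
  constructor
  · intro h
    have hpos : 0 < l.sum := by cases h <;> simp
    refine ⟨hpos, ?_⟩
    rintro ⟨l₁, l₂, m₁, m₂, h1, h2, h3, h4, h5⟩
    have hs : l.sum = l₁.sum + l₂.sum := by rw [h1, List.sum_append]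
    have hs' : m.sum = m₁.sum + m₂.sum := by rw [h2, List.sum_append]
    have hl₁ : l₁ ≠ [] := by
      rintro rfl
      rw [List.sum_nil] at hs
      omega
    have hm₁ : m₁ ≠ [] := by
      rintro rfl
      rw [List.sum_nil] at h3
      omega
    obtain ⟨a, l₁, rfl⟩ := List.exists_cons_of_ne_nil hl₁
    obtain ⟨b, m₁, rfl⟩ := List.exists_cons_of_ne_nil hm₁
    have key : l₂ = [] ∧ m₂ = [] := by
      cases h with
      | two_two h =>
        obtain ⟨rfl, rfl⟩ := Prod.mk.inj h
        exact noProperPrefix_nil 0 _ _ _ _ (List.cons.inj h1).2 (List.cons.inj h2).2 (by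
          simp only [List.sum_cons, ← (List.cons.inj h1).1, ← (List.cons.inj h2).1] at h3
          omega)
      | three_three h =>
        obtain ⟨rfl, rfl⟩ := Prod.mk.inj h
        exact noProperPrefix_nil 0 _ _ _ _ (List.cons.inj h1).2 (List.cons.inj h2).2 (by
          simp only [List.sum_cons, ← (List.cons.inj h1).1, ← (List.cons.inj h2).1] at h3
          omega)
      | two_three h =>
        exact h.noProperPrefix _ _ _ _ (List.cons.inj h1).2 (List.cons.inj h2).2 (by
          simp only [List.sum_cons, ← (List.cons.inj h1).1, ← (List.cons.inj h2).1] at h3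
          simp
          omega)
      | three_two h =>
        exact (h.noProperPrefix _ _ _ _ (List.cons.inj h2).2 (List.cons.inj h1).2 (by
          simp only [List.sum_cons, ← (List.cons.inj h1).1, ← (List.cons.inj h2).1] at h3
          simp
          omega)).symm
    rw [key.1, List.sum_nil] at hs
    omega
  · rintro ⟨hpos, hdec⟩
    -- If the remainder had positive sum, both pieces would be strictly smaller and would decompose
    -- the pair.
    have hnp : ∀ l₁ l₂ m₁ m₂ : List ℕ, l = l₁ ++ l₂ → m = m₁ ++ m₂ → l₁.sum = m₁.sum →
        0 < l₁.sum → l₂ = [] ∧ m₂ = [] := by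
      intro l₁ l₂ m₁ m₂ h1 h2 h3 h4
      have hs : l.sum = l₁.sum + l₂.sum := by rw [h1, List.sum_append]
      have hs' : m.sum = m₁.sum + m₂.sum := by rw [h2, List.sum_append]
      have h5 : l₂.sum = 0 := by
        by_contra h5
        exact hdec ⟨l₁, l₂, m₁, m₂, h1, h2, h3, by omega, by omega⟩
      have hl₂ : IsTwoThree l₂ := fun p hp => hl p (h1 ▸ List.mem_append_right _ hp)
      have hm₂ : IsTwoThree m₂ := fun p hp => hm p (h2 ▸ List.mem_append_right _ hp)
      exact ⟨hl₂.eq_nil h5, hm₂.eq_nil (by omega)⟩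
    obtain ⟨l', hl', rfl | rfl⟩ := hl.exists_cons hpos <;>
    obtain ⟨m', hm', rfl | rfl⟩ := hm.exists_cons (hlm ▸ hpos) <;>
    simp only [List.sum_cons] at hlm
    · obtain ⟨rfl, rfl⟩ := hnp [2] l' [2] m' rfl rfl rfl two_pos
      exact .two_two rfl
    · refine .two_three (Chain.of_noProperPrefix hl' hm' (by simp; omega) ?_)
      intro l₁ l₂ m₁ m₂ h1 h2 h3
      refine hnp (2 :: l₁) l₂ (3 :: m₁) m₂ (by rw [h1]; rfl) (by rw [h2]; rfl) ?_ (by simp)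
      simp at h3 ⊢
      omega
    · refine .three_two (Chain.of_noProperPrefix hm' hl' (by simp; omega) ?_)
      intro m₁ m₂ l₁ l₂ h2 h1 h3
      refine (hnp (3 :: l₁) l₂ (2 :: m₁) m₂ (by rw [h1]; rfl) (by rw [h2]; rfl) ?_ (by simp)).symm
      simp at h3 ⊢
      omega
    · obtain ⟨rfl, rfl⟩ := hnp [3] l' [3] m' rfl rfl rfl three_pos
      exact .three_three rfl

theorem indecMeanderCount_eq (n k : ℕ) :
    indecMeanderCount {2, 3} n k = Set.ncard {p | p ∈ firstReturnSet {([], [])} ∧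
      p.1.sum = n ∧ pairIndex₀ 1 p = k} := by
  have := ncard_meander_eq one_pos n k Meander.Indecomposable (firstReturnSet {([], [])})
    (firstReturnSet_subset nil_subset_balancedPairs) ?_
  · simp only [mul_one, one_mul] at this
    exact this
  · rintro M ⟨l, m⟩ hp h
    have hmap : ∀ l : List ℕ, l.map (1 * ·) = l := fun l => by simp
    obtain ⟨h1, h2⟩ := Prod.mk.inj h
    rw [hmap] at h1 h2
    dsimp only at h1 h2
    have hn : l.sum = n := by rw [← h1, M.top.blocks_sum]
    rw [Meander.Indecomposable, M.decomposable_iff, h1, h2, ← hn]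
    exact (firstReturn_nil_iff hp).symm

end Indecomposable

/-! ### Closed form and recurrence -/

section Main

theorem coeff_X_pow_mul_X_pow_eq_zero {a : ℕ} (b : ℕ) {d : Fin 2 →₀ ℕ} (h : a < d 0) :
    MvPowerSeries.coeff d ((MvPowerSeries.X 0 : MvPowerSeries (Fin 2) ℚ) ^ a *
      MvPowerSeries.X 1 ^ b) = 0 := by
  rw [X_pow_mul_X_pow, MvPowerSeries.coeff_monomial, if_neg]
  rintro rfl
  simp at h

theorem coeff_X_pow_mul_pairGenFun {a n : ℕ} (b k : ℕ) (T : Set (List ℕ × List ℕ))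
    (w : List ℕ × List ℕ → ℕ) (ha : a ≤ n) :
    MvPowerSeries.coeff (Finsupp.single 0 n + Finsupp.single 1 k)
        (MvPowerSeries.X 0 ^ a * MvPowerSeries.X 1 ^ b * pairGenFun T w) =
      if b ≤ k then (Set.ncard {p | p ∈ T ∧ p.1.sum = n - a ∧ w p = k - b} : ℚ) else 0 := by
  rw [coeff_X_pow_mul, coeff_pairGenFun]
  simp [ha]

/-- With the empty pair as the only endpoint, `B = 1`, and the right side of
`pairGenFun_firstReturnSet_mul` is a polynomial of degree 6 in `x`. Beyond that degree only the
denominator `1 - x - x³y` acts on the coefficients. -/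
theorem indecMeanderCount_recurrence {n : ℕ} (hn : 6 < n) (k : ℕ) :
    indecMeanderCount {2, 3} n k = indecMeanderCount {2, 3} (n - 1) k +
      if 1 ≤ k then indecMeanderCount {2, 3} (n - 3) (k - 1) else 0 := by
  set I := pairGenFun (firstReturnSet {([], [])}) (pairIndex₀ 1) with hI
  set x : MvPowerSeries (Fin 2) ℚ := MvPowerSeries.X 0 with hx
  set y : MvPowerSeries (Fin 2) ℚ := MvPowerSeries.X 1 with hy
  have h := pairGenFun_firstReturnSet_mul nil_subset_balancedPairs hx hy
  rw [pairGenFun_nil, ← hI] at h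
  have h' : x ^ 0 * y ^ 0 * I = x ^ 1 * y ^ 0 * I + x ^ 3 * y ^ 1 * I + x ^ 2 * y ^ 2 +
      x ^ 3 * y ^ 3 - x ^ 3 * y ^ 2 - x ^ 4 * y ^ 3 - x ^ 5 * y ^ 3 - x ^ 6 * y ^ 4 +
      x ^ 5 * y ^ 1 + x ^ 5 * y ^ 1 := by
    linear_combination h
  have hc := congrArg (MvPowerSeries.coeff (Finsupp.single 0 n + Finsupp.single 1 k)) h'
  have hd : ∀ a ≤ 6, a < (Finsupp.single 0 n + Finsupp.single 1 k : Fin 2 →₀ ℕ) 0 := by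
    intro a ha
    simp
    omega
  simp only [map_add, map_sub, hx, hy, hI] at hc
  rw [coeff_X_pow_mul_pairGenFun _ _ _ _ (Nat.zero_le n),
    coeff_X_pow_mul_pairGenFun _ _ _ _ (by omega : 1 ≤ n),
    coeff_X_pow_mul_pairGenFun _ _ _ _ (by omega : 3 ≤ n),
    coeff_X_pow_mul_X_pow_eq_zero 2 (hd 2 (by norm_num)),
    coeff_X_pow_mul_X_pow_eq_zero 3 (hd 3 (by norm_num)),
    coeff_X_pow_mul_X_pow_eq_zero 2 (hd 3 (by norm_num)),
    coeff_X_pow_mul_X_pow_eq_zero 3 (hd 4 (by norm_num)),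
    coeff_X_pow_mul_X_pow_eq_zero 3 (hd 5 (by norm_num)),
    coeff_X_pow_mul_X_pow_eq_zero 4 (hd 6 (by norm_num)),
    coeff_X_pow_mul_X_pow_eq_zero 1 (hd 5 (by norm_num))] at hc
  simp only [← indecMeanderCount_eq, Nat.zero_le, if_true, Nat.sub_zero, add_zero, sub_zero] at hc
  split_ifs at hc ⊢ with hk
  · exact_mod_cast hc
  · exact_mod_cast hc

/-- With all balanced pairs as endpoints, the first-return relation and `A = 1 + first returns` form
a linear equation for `A`; its leading coefficient has constant term 1 and is therefore invertible.
-/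
theorem meanderGenFun_two_three_eq {x y : MvPowerSeries (Fin 2) ℚ}
    (hx : x = MvPowerSeries.X 0) (hy : y = MvPowerSeries.X 1) :
    meanderGenFun {2, 3} = (1 - x - x ^ 3 * y) *
      ((1 - x ^ 2 * y ^ 2 - x ^ 3 * y ^ 3) * (1 - x - x ^ 3 * y) - 2 * x ^ 5 * y)⁻¹ := by
  rw [MvPowerSeries.eq_mul_inv_iff_mul_eq]
  · have h1 := pairGenFun_balancedPairs
    have h2 := pairGenFun_firstReturnSet_mul subset_rfl hx hy
    rw [meanderGenFun_two_three]
    linear_combination (1 - x - x ^ 3 * y) * h1 + h2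
  · rw [hx, hy]
    simp

end Main

end SeaweedIndex

theorem mainTheorem8 (x y : MvPowerSeries (Fin 2) ℚ)
    (hx : x = MvPowerSeries.X 0) (hy : y = MvPowerSeries.X 1) :
    -- the closed form (the denominator has constant term 1)
    meanderGenFun {2, 3} =
        (1 - x - x ^ 3 * y) *
          ((1 - x ^ 2 * y ^ 2 - x ^ 3 * y ^ 3) * (1 - x - x ^ 3 * y) - 2 * x ^ 5 * y)⁻¹ ∧
    -- the recurrence for indecomposable meanders, with `i_{n,-1} = 0`
    (∀ n : ℕ, 6 < n →
      indecMeanderCount {2, 3} n 0 = indecMeanderCount {2, 3} (n - 1) 0 ∧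
      ∀ k : ℕ, 1 ≤ k →
        indecMeanderCount {2, 3} n k =
          indecMeanderCount {2, 3} (n - 1) k + indecMeanderCount {2, 3} (n - 3) (k - 1)) ∧
    -- the inflation formula
    (∀ c : ℕ, 1 ≤ c →
      meanderGenFun {2 * c, 3 * c} =
        MvPowerSeries.subst ![x ^ c, y ^ c] (meanderGenFun {2, 3})) := by
  refine ⟨meanderGenFun_two_three_eq hx hy, fun n hn => ⟨?_, fun k hk => ?_⟩, fun c hc => ?_⟩
  · simpa using indecMeanderCount_recurrence hn 0
  · rw [indecMeanderCount_recurrence hn k, if_pos hk]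
  · have hc' : c ≠ 0 := by omega
    have hxy : ![x ^ c, y ^ c] = fun i : Fin 2 => (MvPowerSeries.X i : MvPowerSeries (Fin 2) ℚ) ^ c := by
      ext1 i
      fin_cases i
      · rw [hx]; rfl
      · rw [hy]; rfl
    rw [meanderGenFun_inflate hc', hxy, MvPowerSeries.expand, MvPowerSeries.substAlgHom_apply]
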